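/- Consider the memoryless complex-valued channel $$\mathbf Y=\mathbf X+\sqrt{\mathsf I}\,e^{j\Theta}+\mathbf Z ,$$ where the input $\mathbf X$ is a complex random variable with $\mathbb E[|\mathbf X|^2]\le \mathsf S$, the phase $\Theta$ is uniformly distributed on $[0,2\pi]$, $\mathbf Z$ is zero-mean proper-complex (circularly symmetric) Gaussian with $\mathbb E[|\mathbf Z|^2]=1$, and $\mathbf X,\Theta,\mathbf Z$ are mutually independent. Here $\mathsf S\ge 0$ is the signal-to-noise ratio and $\mathsf I\ge 0$ the interference-to-noise ratio. Let $I(\mathbf X;\mathbf Y)$ denote mutual information, let $\log$ be the natural logarithm (rates in nats), and let $$\mathsf C(\mathsf S,\mathsf I)=\sup_{F_{\mathbf X}:\ \mathbb E[|\mathbf X|^2]\le \mathsf S} I(\mathbf X;\mathbf Y)$$ be the capacity, the supremum being over all laws $F_{\mathbf X}$ of $\mathbf X$ on $\mathbb C$ that satisfy the power constraint. Then for every $\mathsf S\ge 0$: 1. $\displaystyle\lim_{\mathsf I\to\infty}\mathsf C(\mathsf S,\mathsf I)=\tfrac12\log(1+\mathsf S)$, which is half the capacity $\mathsf C(\mathsf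 S,0)=\log(1+\mathsf S)$ of the interference-free channel (half the degrees of freedom). 2. For every fixed input law with $\mathbb E[|\mathbf X|^2]\le \mathsf S$, $\displaystyle\limsup_{\mathsf I\to\infty} I(\mathbf X;\mathbf Y)\le \tfrac12\log(1+\mathsf S)$. 3. The zero-mean proper-complex Gaussian input $\mathbf X_G$ with $\mathbb E[|\mathbf X_G|^2]=\mathsf S$ satisfies the power constraint and asymptotically achieves the limit: $\displaystyle\lim_{\mathsf I\to\infty} I(\mathbf X_G;\mathbf Y)=\tfrac12\log(1+\mathsf S)$. -/

import Mathlib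

open MeasureTheory ProbabilityTheory InformationTheory Filter Topology
open scoped NNReal ENNReal

noncomputable section

namespace RadarChannel

/-- Zero-mean proper-complex (circularly symmetric) Gaussian law on `ℂ` with variance
`E|Z|² = v`: independent real and imaginary parts, each of law `N(0, v/2)`. -/
def complexGaussian (v : ℝ≥0) : Measure ℂ :=
  ((gaussianReal 0 (v / 2)).prod (gaussianReal 0 (v / 2))).map
    (fun p : ℝ × ℝ => (⟨p.1, p.2⟩ : ℂ))

/-- The uniform probability law on `[0, 2π]`. -/
def uniformPhase : Measure ℝ :=
  ProbabilityTheory.cond volume (Set.Icc 0 (2 * Real.pi))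

/-- The channel `Y = X + √inr · exp(jΘ) + Z` as a function of `(X, Θ, Z)`. -/
def channelOutput (inr : ℝ) (x : ℂ) (θ : ℝ) (z : ℂ) : ℂ :=
  x + ((Real.sqrt inr : ℂ) * Complex.exp ((θ : ℂ) * Complex.I) + z)

/-- The joint law of the pair (input, output) when `X` has law `F`, `Θ` is uniform on `[0, 2π]`,
`Z` is proper-complex Gaussian of unit variance, and `X`, `Θ`, `Z` are mutually independent. -/
def inputOutputLaw (F : Measure ℂ) (inr : ℝ) : Measure (ℂ × ℂ) :=
  (F.prod (uniformPhase.prod (complexGaussian 1))).map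
    (fun p : ℂ × ℝ × ℂ => (p.1, channelOutput inr p.1 p.2.1 p.2.2))

/-- Mutual information (in nats) of a pair of random variables with joint law `P`: the relative
entropy of `P` with respect to the product of its marginals. -/
def mutualInformation {α β : Type*} [MeasurableSpace α] [MeasurableSpace β]
    (P : Measure (α × β)) : ℝ≥0∞ :=
  klDiv P (P.fst.prod P.snd)

/-- `I(X;Y)` for an input `X` of law `F` at interference-to-noise ratio `inr`. -/
def inputOutputInformation (F : Measure ℂ) (inr : ℝ) : ℝ≥0∞ :=
  mutualInformation (inputOutputLaw F inr)

/-- `F` is the law of an input `X` with `E|X|² ≤ S`. -/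
def IsAdmissibleInput (S : ℝ≥0) (F : Measure ℂ) : Prop :=
  IsProbabilityMeasure F ∧ ∫⁻ x, ‖x‖ₑ ^ 2 ∂F ≤ (S : ℝ≥0∞)

/-- The capacity `C(S, inr)`: supremum of `I(X;Y)` over all inputs with `E|X|² ≤ S`. -/
def capacity (S : ℝ≥0) (inr : ℝ) : ℝ≥0∞ :=
  ⨆ (F : Measure ℂ) (_ : IsAdmissibleInput S F), inputOutputInformation F inr

end RadarChannel

end

/-! Write r = √I. Conditioning on X gives I(X;Y) = h(Y) − h(r·exp(jΘ) + Z), so everything rests on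
the law of a uniform ring of radius r blurred by Gaussian noise of variance v. Its density is (πv)⁻¹
exp(−(|y|−r)²/v) · e^{−s}I₀(s) with s = 2|y|r/v. Since √s·e^{−s}I₀(s) → 1/√(2π), minus its logarithm
is log(πv) + (|y|−r)²/v + ½ log(1+s), less a bounded correction that tends to κ = log(1/√(2π)). Seen
from a large ring, a perturbation u of the point r·exp(jΘ) moves the modulus by the component of u
along exp(jΘ), which carries half of the power of u. Hence the entropy is log(πv) + ½ + ½ log(1 +
2r²/v) − κ + o(1) (`tendsto_ringEntropy`). Replacing v = 1 by v = 1+S gains log(1+S) in the first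
term and loses ½ log(1+S) in the third: this is the factor one half.

For a Gaussian input the output is itself a ring law with v = 1+S, so the lower bound is a
difference of two such entropies (`inputOutputInformation_complexGaussian`).

The upper bound has to be uniform over inputs of which only the second moment is controlled. The
Gibbs inequality bounds h(Y) by the cross entropy relative to any test density. Against the ring
density with v = 1+S the expansion has an error cubic in x, so it is used only for |x|² ≤ √I, where
the cubic error is a small multiple of |x|². For larger x the test density contains a Gaussian of
variance 1+I with weight 1/(1+I); the cost, of order log(1+I), is negligible against |x|² ≥ √I. The
total error is η(1+|x|²+|z|²+|z|³) (`eventually_neg_log_testDensity_le`), whose mean is at most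
η(2+S+E|Z|³), and `eventually_capacity_le` follows. The bound for a fixed input is then immediate,
and I = 0 is the case r = 0 of the same formulas. -/

noncomputable section

namespace RadarChannel

/-! ### Uniform phase and asymptotics of the scaled Bessel function. -/

open Real in
theorem uniformPhase_eq :
    uniformPhase = ENNReal.ofReal (2 * π)⁻¹ • volume.restrict (Set.Icc 0 (2 * π)) := by
  have h : (0 : ℝ) < 2 * π := by positivity
  rw [uniformPhase, ProbabilityTheory.cond, Real.volume_Icc, sub_zero,
    ENNReal.ofReal_inv_of_pos h]

instance : IsProbabilityMeasure uniformPhase :=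
  cond_isProbabilityMeasure_of_finite (by
    rw [Real.volume_Icc, sub_zero]
    exact (ENNReal.ofReal_pos.2 (by positivity)).ne')
    (by rw [Real.volume_Icc]; exact ENNReal.ofReal_ne_top)

open Real in
theorem integral_uniformPhase (f : ℝ → ℝ) :
    ∫ θ, f θ ∂uniformPhase = (2 * π)⁻¹ * ∫ θ in (0 : ℝ)..2 * π, f θ := by
  have h : (0 : ℝ) < 2 * π := by positivity
  rw [uniformPhase_eq, integral_smul_measure, integral_Icc_eq_integral_Ioc,
    intervalIntegral.integral_of_le h.le, ENNReal.toReal_ofReal (by positivity), smul_eq_mul]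

theorem integral_uniformPhase_sub {f : ℝ → ℝ} (hf : Function.Periodic f (2 * Real.pi)) (a : ℝ) :
    ∫ θ, f (θ - a) ∂uniformPhase = ∫ θ, f θ ∂uniformPhase := by
  rw [integral_uniformPhase, integral_uniformPhase, intervalIntegral.integral_comp_sub_right]
  have := hf.intervalIntegral_add_eq (0 - a) 0
  rw [zero_add] at this
  rw [← this]
  congr 2
  ring

/-- The exponentially scaled modified Bessel function `exp (-s) * I₀ s`. -/
def scaledBessel (s : ℝ) : ℝ :=
  ∫ θ, Real.exp (-(s * (1 - Real.cos θ))) ∂uniformPhase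

theorem scaledBessel_integrand_le_one {s : ℝ} (hs : 0 ≤ s) (θ : ℝ) :
    Real.exp (-(s * (1 - Real.cos θ))) ≤ 1 := by
  rw [Real.exp_le_one_iff]
  have := mul_nonneg hs (sub_nonneg.2 (Real.cos_le_one θ))
  linarith

theorem integrable_scaledBessel_integrand {s : ℝ} (hs : 0 ≤ s) :
    Integrable (fun θ => Real.exp (-(s * (1 - Real.cos θ)))) uniformPhase := by
  refine Integrable.of_bound (C := 1) (by fun_prop) (ae_of_all _ fun θ => ?_)
  rw [Real.norm_of_nonneg (Real.exp_nonneg _)]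
  exact scaledBessel_integrand_le_one hs θ

theorem scaledBessel_le_one {s : ℝ} (hs : 0 ≤ s) : scaledBessel s ≤ 1 := by
  have := integral_mono (integrable_scaledBessel_integrand hs) (integrable_const (1 : ℝ))
    (scaledBessel_integrand_le_one hs)
  simpa [scaledBessel] using this

theorem exp_neg_two_mul_le_scaledBessel {s : ℝ} (hs : 0 ≤ s) :
    Real.exp (-(2 * s)) ≤ scaledBessel s := by
  have := integral_mono (integrable_const (Real.exp (-(2 * s))))
    (integrable_scaledBessel_integrand hs) (fun θ => by
      refine Real.exp_le_exp.2 ?_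
      nlinarith [Real.neg_one_le_cos θ])
  simpa [scaledBessel] using this

theorem scaledBessel_pos {s : ℝ} (hs : 0 ≤ s) : 0 < scaledBessel s :=
  (Real.exp_pos _).trans_le (exp_neg_two_mul_le_scaledBessel hs)

theorem scaledBessel_zero : scaledBessel 0 = 1 := by simp [scaledBessel]

theorem measurable_scaledBessel : Measurable scaledBessel := by
  refine StronglyMeasurable.measurable ?_
  refine StronglyMeasurable.integral_prod_right
    (f := fun s θ => Real.exp (-(s * (1 - Real.cos θ)))) ?_
  exact Continuous.stronglyMeasurable (by fun_prop)

open Real in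
theorem scaledBessel_eq_integral_symm (s : ℝ) :
    scaledBessel s = (2 * π)⁻¹ * ∫ θ in (-π)..π, exp (-(s * (1 - cos θ))) := by
  rw [scaledBessel, integral_uniformPhase]
  have hf : Function.Periodic (fun θ => exp (-(s * (1 - cos θ)))) (2 * π) := fun θ => by simp
  have := hf.intervalIntegral_add_eq (-π) 0
  rw [zero_add] at this
  rw [← this]
  congr 2
  ring

open Real in
-- Substitution θ = t/√s; the indicator turns the growing window into an integral over the whole
-- line, ready for dominated convergence.
theorem sqrt_mul_scaledBessel {s : ℝ} (hs : 0 < s) :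
    √s * scaledBessel s = (2 * π)⁻¹ * ∫ t,
      (Set.Ioc (-(π * √s)) (π * √s)).indicator (fun t => exp (-(s * (1 - cos (t / √s))))) t := by
  have h : 0 < √s := Real.sqrt_pos.2 hs
  have hle : -(π * √s) ≤ π * √s := by nlinarith [mul_pos pi_pos h]
  rw [integral_indicator measurableSet_Ioc, ← intervalIntegral.integral_of_le hle,
    intervalIntegral.integral_comp_div (fun θ => exp (-(s * (1 - cos θ)))) h.ne',
    scaledBessel_eq_integral_symm]
  rw [neg_div, mul_div_cancel_right₀ _ h.ne', smul_eq_mul]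
  ring

open Real in
theorem tendsto_mul_one_sub_cos_div_sqrt (t : ℝ) :
    Tendsto (fun s : ℝ => s * (1 - cos (t / √s))) atTop (𝓝 (t ^ 2 / 2)) := by
  -- The constant 5/96 is the quartic remainder in `Real.cos_bound`, which applies once s ≥ t².
  have hlow : Tendsto (fun s : ℝ => t ^ 2 / 2 - t ^ 4 * (5 / 96) * s⁻¹) atTop (𝓝 (t ^ 2 / 2)) := by
    have := (tendsto_inv_atTop_zero (𝕜 := ℝ)).const_mul (t ^ 4 * (5 / 96))
    simpa using this.const_sub (t ^ 2 / 2)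
  refine tendsto_of_tendsto_of_tendsto_of_le_of_le' hlow tendsto_const_nhds ?_ ?_
  · filter_upwards [eventually_ge_atTop (t ^ 2), eventually_gt_atTop 0] with s hs hs0
    have h : 0 < √s := Real.sqrt_pos.2 hs0
    have habs : |t / √s| ≤ 1 := by
      rw [abs_div, abs_of_pos h, div_le_one h]
      exact Real.abs_le_sqrt hs
    have hb := abs_le.1 (Real.cos_bound habs)
    have e2 : (t / √s) ^ 2 = t ^ 2 / s := by rw [div_pow, Real.sq_sqrt hs0.le]
    have e4 : |t / √s| ^ 4 = t ^ 4 / s ^ 2 := by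
      rw [Even.pow_abs (by decide), show (t / √s) ^ 4 = ((t / √s) ^ 2) ^ 2 by ring, e2]
      ring
    rw [e4, e2] at hb
    have h1 : t ^ 2 / s / 2 - t ^ 4 / s ^ 2 * (5 / 96) ≤ 1 - cos (t / √s) := by linarith [hb.2]
    refine le_trans (le_of_eq ?_) (mul_le_mul_of_nonneg_left h1 hs0.le)
    field_simp
  · filter_upwards [eventually_gt_atTop 0] with s hs0
    have h1 : 1 - cos (t / √s) ≤ t ^ 2 / s / 2 := by
      have := Real.one_sub_sq_div_two_le_cos (x := t / √s)
      rw [div_pow, Real.sq_sqrt hs0.le] at this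
      linarith
    refine (mul_le_mul_of_nonneg_left h1 hs0.le).trans (le_of_eq ?_)
    field_simp

open Real in
theorem tendsto_sqrt_mul_scaledBessel :
    -- Laplace's method: after rescaling, the integrand converges to exp(−t²/2).
    Tendsto (fun s : ℝ => √s * scaledBessel s) atTop (𝓝 (√(2 * π))⁻¹) := by
  have hlim : Tendsto (fun s : ℝ => ∫ t,
      (Set.Ioc (-(π * √s)) (π * √s)).indicator (fun t => exp (-(s * (1 - cos (t / √s))))) t)
      atTop (𝓝 (∫ t : ℝ, exp (-(1 / 2) * t ^ 2))) := by
    -- The bound 1 − cos θ ≥ (2/π²)θ² on all of [−π, π] gives one Gaussian dominating every rescaled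
    -- integrand.
    refine tendsto_integral_filter_of_dominated_convergence
      (fun t => exp (-(2 / π ^ 2) * t ^ 2)) ?_ ?_ ?_ ?_
    · refine Eventually.of_forall fun s => ?_
      exact ((Measurable.indicator (by fun_prop) measurableSet_Ioc)).aestronglyMeasurable
    · filter_upwards [eventually_gt_atTop 0] with s hs0
      refine ae_of_all _ fun t => ?_
      have h : 0 < √s := Real.sqrt_pos.2 hs0
      by_cases ht : t ∈ Set.Ioc (-(π * √s)) (π * √s)
      · rw [Set.indicator_of_mem ht, Real.norm_of_nonneg (exp_nonneg _), exp_le_exp]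
        have habs : |t / √s| ≤ π := by
          rw [abs_div, abs_of_pos h, div_le_iff₀ h]
          exact abs_le.2 ⟨ht.1.le, ht.2⟩
        have hc := Real.cos_le_one_sub_mul_cos_sq habs
        rw [div_pow, Real.sq_sqrt hs0.le] at hc
        have h1 : 2 / π ^ 2 * (t ^ 2 / s) ≤ 1 - cos (t / √s) := by linarith
        have h2 := mul_le_mul_of_nonneg_left h1 hs0.le
        have h3 : s * (2 / π ^ 2 * (t ^ 2 / s)) = 2 / π ^ 2 * t ^ 2 := by field_simp
        linarith
      · rw [Set.indicator_of_notMem ht, norm_zero]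
        exact exp_nonneg _
    · exact integrable_exp_neg_mul_sq (by positivity)
    · refine ae_of_all _ fun t => ?_
      have h1 : Tendsto (fun s : ℝ => exp (-(s * (1 - cos (t / √s))))) atTop
          (𝓝 (exp (-(1 / 2) * t ^ 2))) := by
        have := (Real.continuous_exp.tendsto _).comp (tendsto_mul_one_sub_cos_div_sqrt t).neg
        rwa [show -(t ^ 2 / 2) = -(1 / 2) * t ^ 2 by ring] at this
      refine h1.congr' ?_
      filter_upwards [(tendsto_sqrt_atTop.const_mul_atTop pi_pos).eventually_gt_atTop |t|] with s hs
      rw [Set.indicator_of_mem]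
      exact ⟨(abs_lt.1 hs).1, (abs_lt.1 hs).2.le⟩
  have hval : (√(2 * π))⁻¹ = (2 * π)⁻¹ * ∫ t : ℝ, exp (-(1 / 2) * t ^ 2) := by
    rw [integral_gaussian, show π / (1 / 2) = 2 * π by ring]
    have h : 0 < √(2 * π) := by positivity
    have h2 : √(2 * π) * √(2 * π) = 2 * π := Real.mul_self_sqrt (by positivity)
    nth_rewrite 2 [← h2]
    field_simp
  rw [hval]
  refine (hlim.const_mul _).congr' ?_
  filter_upwards [eventually_gt_atTop 0] with s hs
  exact (sqrt_mul_scaledBessel hs).symm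

/-- The logarithm of the scaled Bessel function, compensated for its decay. -/
def logBesselCorrection (s : ℝ) : ℝ :=
  Real.log (scaledBessel s) + 1 / 2 * Real.log (1 + s)

theorem logBesselCorrection_zero : logBesselCorrection 0 = 0 := by
  simp [logBesselCorrection, scaledBessel_zero]

theorem tendsto_logBesselCorrection :
    Tendsto logBesselCorrection atTop (𝓝 (Real.log (√(2 * Real.pi))⁻¹)) := by
  have h1 := tendsto_sqrt_mul_scaledBessel.log (by positivity)
  have h2 : Tendsto (fun s : ℝ => 1 / 2 * Real.log (1 + s⁻¹)) atTop (𝓝 0) := by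
    have := ((tendsto_inv_atTop_zero (𝕜 := ℝ)).const_add 1).log (by norm_num)
    simpa using this.const_mul (1 / 2 : ℝ)
  have h3 := h1.add h2
  rw [add_zero] at h3
  refine h3.congr' ?_
  filter_upwards [eventually_gt_atTop 0] with s hs
  have hB := scaledBessel_pos hs.le
  rw [logBesselCorrection, Real.log_mul (Real.sqrt_pos.2 hs).ne' hB.ne', Real.log_sqrt hs.le,
    show 1 + s = s * (1 + s⁻¹) by field_simp; ring, Real.log_mul hs.ne' (by positivity)]
  ring

/-- Far out the limit bounds the function; below the threshold e^{−2s} ≤ `scaledBessel s` ≤ 1 does.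
Compensating by log(1+s) instead of log s keeps it finite at 0. -/
theorem exists_abs_logBesselCorrection_le :
    ∃ B : ℝ, 0 ≤ B ∧ ∀ s, 0 ≤ s → |logBesselCorrection s| ≤ B := by
  set κ := Real.log (√(2 * Real.pi))⁻¹
  obtain ⟨A, hA⟩ := eventually_atTop.1 (tendsto_logBesselCorrection.eventually
    (Metric.ball_mem_nhds κ one_pos))
  refine ⟨|κ| + 1 + 3 * |A|, by positivity, fun s hs => ?_⟩
  rcases le_total A s with h | h
  · have := hA s h
    rw [Real.dist_eq] at this
    have h2 : |logBesselCorrection s| ≤ |logBesselCorrection s - κ| + |κ| := by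
      simpa using abs_add_le (logBesselCorrection s - κ) κ
    linarith [abs_nonneg A]
  · have hsA : s ≤ |A| := h.trans (le_abs_self A)
    have h1 : Real.log (scaledBessel s) ≤ 0 :=
      Real.log_nonpos (scaledBessel_pos hs).le (scaledBessel_le_one hs)
    have h2 : -(2 * s) ≤ Real.log (scaledBessel s) :=
      (Real.le_log_iff_exp_le (scaledBessel_pos hs)).2 (exp_neg_two_mul_le_scaledBessel hs)
    have h3 : 0 ≤ Real.log (1 + s) := Real.log_nonneg (by linarith)
    have h4 : Real.log (1 + s) ≤ s := by
      have := Real.log_le_sub_one_of_pos (show 0 < 1 + s by linarith)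
      linarith
    rw [abs_le, logBesselCorrection]
    constructor <;> linarith [abs_nonneg κ]

/-! ### The complex Gaussian law: convolution, moments, density. -/

theorem measurable_complex_mk : Measurable (fun p : ℝ × ℝ => (⟨p.1, p.2⟩ : ℂ)) :=
  Complex.measurableEquivRealProd.symm.measurable

instance (v : ℝ≥0) : IsProbabilityMeasure (complexGaussian v) :=
  Measure.isProbabilityMeasure_map measurable_complex_mk.aemeasurable

theorem map_re_complexGaussian (v : ℝ≥0) :
    (complexGaussian v).map Complex.re = gaussianReal 0 (v / 2) := by
  rw [complexGaussian, Measure.map_map Complex.measurable_re measurable_complex_mk]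
  exact measurePreserving_fst.map_eq

theorem map_im_complexGaussian (v : ℝ≥0) :
    (complexGaussian v).map Complex.im = gaussianReal 0 (v / 2) := by
  rw [complexGaussian, Measure.map_map Complex.measurable_im measurable_complex_mk]
  exact measurePreserving_snd.map_eq

theorem lintegral_complexGaussian (v : ℝ≥0) {f : ℂ → ℝ≥0∞} (hf : Measurable f) :
    ∫⁻ z, f z ∂complexGaussian v =
      ∫⁻ x, ∫⁻ y, f ⟨x, y⟩ ∂gaussianReal 0 (v / 2) ∂gaussianReal 0 (v / 2) := by
  rw [complexGaussian, lintegral_map hf measurable_complex_mk,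
    lintegral_prod (fun p : ℝ × ℝ => f ⟨p.1, p.2⟩) (hf.comp measurable_complex_mk).aemeasurable]

theorem lintegral_lintegral_gaussianReal_add (a b : ℝ≥0) {f : ℝ → ℝ≥0∞} (hf : Measurable f) :
    ∫⁻ x, ∫⁻ y, f (x + y) ∂gaussianReal 0 b ∂gaussianReal 0 a =
      ∫⁻ x, f x ∂gaussianReal 0 (a + b) := by
  have h := gaussianReal_conv_gaussianReal (m₁ := 0) (m₂ := 0) (v₁ := a) (v₂ := b)
  rw [add_zero] at h
  rw [← h, Measure.lintegral_conv hf]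

theorem lintegral_lintegral_complexGaussian_add (a b : ℝ≥0) {f : ℂ → ℝ≥0∞} (hf : Measurable f) :
    ∫⁻ x, ∫⁻ y, f (x + y) ∂complexGaussian b ∂complexGaussian a =
      ∫⁻ x, f x ∂complexGaussian (a + b) := by
  have hmk : Measurable fun p : ℝ × ℝ => f ⟨p.1, p.2⟩ := hf.comp measurable_complex_mk
  have h2 : Measurable fun x : ℝ => ∫⁻ y, f ⟨x, y⟩ ∂gaussianReal 0 ((a + b) / 2) :=
    hmk.lintegral_prod_right'
  have hadd : (a + b) / 2 = a / 2 + b / 2 := add_div _ _ _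
  rw [lintegral_complexGaussian _ hf, hadd, ← lintegral_lintegral_gaussianReal_add _ _
    (by rw [← hadd]; exact h2), lintegral_complexGaussian]
  · refine lintegral_congr fun x₁ => ?_
    calc ∫⁻ y₁, ∫⁻ w, f (⟨x₁, y₁⟩ + w) ∂complexGaussian b ∂gaussianReal 0 (a / 2)
        = ∫⁻ y₁, ∫⁻ x₂, ∫⁻ y₂, f ⟨x₁ + x₂, y₁ + y₂⟩ ∂gaussianReal 0 (b / 2)
            ∂gaussianReal 0 (b / 2) ∂gaussianReal 0 (a / 2) := by
          refine lintegral_congr fun y₁ => ?_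
          exact lintegral_complexGaussian _ (hf.comp (measurable_const_add _))
      _ = ∫⁻ x₂, ∫⁻ y₁, ∫⁻ y₂, f ⟨x₁ + x₂, y₁ + y₂⟩ ∂gaussianReal 0 (b / 2)
            ∂gaussianReal 0 (a / 2) ∂gaussianReal 0 (b / 2) := by
          refine lintegral_lintegral_swap (Measurable.aemeasurable ?_)
          refine Measurable.lintegral_prod_right'
            (f := fun q : (ℝ × ℝ) × ℝ => f ⟨x₁ + q.1.2, q.1.1 + q.2⟩) ?_
          exact hmk.comp (g := fun p : ℝ × ℝ => f ⟨p.1, p.2⟩)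
            (f := fun q : (ℝ × ℝ) × ℝ => (x₁ + q.1.2, q.1.1 + q.2)) (by fun_prop)
      _ = _ := by
          refine lintegral_congr fun x₂ => ?_
          exact lintegral_lintegral_gaussianReal_add _ _
            (hmk.comp (f := fun y : ℝ => (x₁ + x₂, y)) (by fun_prop))
  · exact Measurable.lintegral_prod_right' (f := fun q : ℂ × ℂ => f (q.1 + q.2))
      (hf.comp (by fun_prop))

theorem memLp_re_complexGaussian (v p : ℝ≥0) : MemLp Complex.re p (complexGaussian v) := by
  have h := memLp_id_gaussianReal (μ := 0) (v := v / 2) p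
  rw [← map_re_complexGaussian] at h
  exact h.comp_of_map Complex.measurable_re.aemeasurable

theorem memLp_im_complexGaussian (v p : ℝ≥0) : MemLp Complex.im p (complexGaussian v) := by
  have h := memLp_id_gaussianReal (μ := 0) (v := v / 2) p
  rw [← map_im_complexGaussian] at h
  exact h.comp_of_map Complex.measurable_im.aemeasurable

theorem memLp_norm_complexGaussian (v p : ℝ≥0) :
    MemLp (fun z : ℂ => ‖z‖) p (complexGaussian v) := by
  refine ((memLp_re_complexGaussian v p).norm.add (memLp_im_complexGaussian v p).norm).mono
    (by fun_prop) (ae_of_all _ fun z => ?_)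
  have h := Complex.norm_le_abs_re_add_abs_im z
  simp only [Pi.add_apply, Real.norm_eq_abs, abs_norm]
  exact h.trans (le_abs_self _)

theorem integrable_norm_pow_complexGaussian (v : ℝ≥0) (n : ℕ) :
    Integrable (fun z : ℂ => ‖z‖ ^ n) (complexGaussian v) := by
  rcases Nat.eq_zero_or_pos n with rfl | hn
  · simp
  have h := (memLp_norm_complexGaussian v n).integrable_norm_pow hn.ne'
  simpa using h

theorem integral_re_complexGaussian (v : ℝ≥0) : ∫ z, z.re ∂complexGaussian v = 0 := by
  have h := integral_id_gaussianReal (μ := 0) (v := v / 2)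
  rwa [← map_re_complexGaussian, integral_map Complex.measurable_re.aemeasurable
    (by fun_prop)] at h

theorem integral_im_complexGaussian (v : ℝ≥0) : ∫ z, z.im ∂complexGaussian v = 0 := by
  have h := integral_id_gaussianReal (μ := 0) (v := v / 2)
  rwa [← map_im_complexGaussian, integral_map Complex.measurable_im.aemeasurable
    (by fun_prop)] at h

theorem integral_sq_gaussianReal (v : ℝ≥0) : ∫ x, x ^ 2 ∂gaussianReal 0 v = v := by
  have h := variance_fun_id_gaussianReal (μ := 0) (v := v)
  rw [variance_eq_integral (by fun_prop)] at h
  simpa [integral_id_gaussianReal] using h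

theorem integral_norm_sq_complexGaussian (v : ℝ≥0) : ∫ z, ‖z‖ ^ 2 ∂complexGaussian v = v := by
  have h := integral_sq_gaussianReal (v / 2)
  have hre := h
  have him := h
  rw [← map_re_complexGaussian, integral_map Complex.measurable_re.aemeasurable
    (by fun_prop)] at hre
  rw [← map_im_complexGaussian, integral_map Complex.measurable_im.aemeasurable
    (by fun_prop)] at him
  have e : ∀ z : ℂ, ‖z‖ ^ 2 = z.re ^ 2 + z.im ^ 2 := fun z => by
    rw [Complex.sq_norm, Complex.normSq_apply]
    ring
  simp_rw [e]
  rw [integral_add, hre, him]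
  · push_cast
    ring
  · exact (memLp_re_complexGaussian v 2).integrable_sq
  · exact (memLp_im_complexGaussian v 2).integrable_sq

theorem isAdmissibleInput_complexGaussian (v : ℝ≥0) : IsAdmissibleInput v (complexGaussian v) := by
  refine ⟨inferInstance, le_of_eq ?_⟩
  have h := ofReal_integral_eq_lintegral_ofReal (integrable_norm_pow_complexGaussian v 2)
    (ae_of_all _ fun z => by positivity)
  rw [integral_norm_sq_complexGaussian, ENNReal.ofReal_coe_nnreal] at h
  rw [h]
  refine lintegral_congr fun z => ?_
  rw [← ofReal_norm, ENNReal.ofReal_pow (norm_nonneg _)]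

/-- The density of the law `complexGaussian v`. -/
def complexGaussianDensity (v : ℝ) (z : ℂ) : ℝ :=
  (Real.pi * v)⁻¹ * Real.exp (-(‖z‖ ^ 2 / v))

theorem measurable_complexGaussianDensity (v : ℝ) : Measurable (complexGaussianDensity v) := by
  unfold complexGaussianDensity
  fun_prop

theorem complexGaussianDensity_nonneg {v : ℝ} (hv : 0 ≤ v) (z : ℂ) :
    0 ≤ complexGaussianDensity v z := by
  unfold complexGaussianDensity
  positivity

theorem lintegral_complexGaussian_eq_lintegral_mul {v : ℝ≥0} (hv : v ≠ 0) {f : ℂ → ℝ≥0∞}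
    (hf : Measurable f) :
    ∫⁻ z, f z ∂complexGaussian v = ∫⁻ z, ENNReal.ofReal (complexGaussianDensity v z) * f z := by
  have hv2 : v / 2 ≠ 0 := by positivity
  have hv0 : (0 : ℝ) < v := by positivity
  have hmk : Measurable fun p : ℝ × ℝ => f ⟨p.1, p.2⟩ := hf.comp measurable_complex_mk
  have hpdf : ∀ p : ℝ × ℝ, gaussianPDF 0 (v / 2) p.1 * gaussianPDF 0 (v / 2) p.2 =
      ENNReal.ofReal (complexGaussianDensity v ⟨p.1, p.2⟩) := by
    intro p
    rw [gaussianPDF, gaussianPDF, ← ENNReal.ofReal_mul (gaussianPDFReal_nonneg _ _ _)]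
    congr 1
    have e : ‖(⟨p.1, p.2⟩ : ℂ)‖ ^ 2 = p.1 ^ 2 + p.2 ^ 2 := by
      rw [Complex.sq_norm, Complex.normSq_apply]
      ring
    rw [gaussianPDFReal, gaussianPDFReal, complexGaussianDensity, e]
    push_cast
    rw [show 2 * Real.pi * ((v : ℝ) / 2) = Real.pi * v by ring, mul_mul_mul_comm, ← mul_inv,
      Real.mul_self_sqrt (by positivity), ← Real.exp_add]
    congr 2
    field_simp
    ring
  rw [complexGaussian, lintegral_map hf measurable_complex_mk,
    gaussianReal_of_var_ne_zero _ hv2,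
    prod_withDensity (measurable_gaussianPDF _ _) (measurable_gaussianPDF _ _),
    lintegral_withDensity_eq_lintegral_mul _ (by fun_prop) hmk]
  refine Eq.trans ?_ ((Complex.volume_preserving_equiv_real_prod.symm _).lintegral_comp
    (((measurable_complexGaussianDensity v).ennreal_ofReal).mul hf))
  refine lintegral_congr fun p => ?_
  rw [Pi.mul_apply, hpdf]
  rfl

theorem lintegral_complexGaussianDensity {v : ℝ} (hv : 0 < v) :
    ∫⁻ z, ENNReal.ofReal (complexGaussianDensity v z) = 1 := by
  lift v to ℝ≥0 using hv.le
  have h := lintegral_complexGaussian_eq_lintegral_mul (v := v) (by rintro rfl; simp at hv)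
    (f := fun _ => 1) measurable_const
  simpa using h.symm

/-! ### The blurred ring and its density. -/

/-- The law of `√inr * exp (jΘ) + Z` with uniform phase and `Z` of law `complexGaussian v`. -/
def ringLaw (v : ℝ≥0) (inr : ℝ) : Measure ℂ :=
  (uniformPhase.prod (complexGaussian v)).map
    (fun p : ℝ × ℂ => (√inr : ℂ) * Complex.exp ((p.1 : ℂ) * Complex.I) + p.2)

/-- The density of `ringLaw v inr`. -/
def ringDensity (v inr : ℝ) (y : ℂ) : ℝ :=
  (Real.pi * v)⁻¹ * Real.exp (-((‖y‖ - √inr) ^ 2 / v)) * scaledBessel (2 * ‖y‖ * √inr / v)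

/-- Law of cosines, arranged so that the angular part is exactly the exponent of `scaledBessel`. -/
theorem norm_sub_ring_sq (r : ℝ) (y : ℂ) (θ : ℝ) :
    ‖y - (r : ℂ) * Complex.exp ((θ : ℂ) * Complex.I)‖ ^ 2 =
      (‖y‖ - r) ^ 2 + 2 * ‖y‖ * r * (1 - Real.cos (θ - y.arg)) := by
  have h1 := Complex.norm_mul_cos_arg y
  have h2 := Complex.norm_mul_sin_arg y
  rw [Complex.sq_norm, Complex.normSq_apply]
  simp only [Complex.sub_re, Complex.sub_im, Complex.re_ofReal_mul, Complex.im_ofReal_mul,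
    Complex.exp_ofReal_mul_I_re, Complex.exp_ofReal_mul_I_im]
  rw [← h1, ← h2, Real.cos_sub]
  linear_combination ‖y‖ ^ 2 * Real.sin_sq_add_cos_sq y.arg + r ^ 2 * Real.sin_sq_add_cos_sq θ

/-- By periodicity the shift by arg y disappears under the uniform phase, so the mixture depends on
|y| only. -/
theorem ringDensity_eq_integral (v inr : ℝ) (y : ℂ) :
    ringDensity v inr y = ∫ θ, complexGaussianDensity v
      (y - (√inr : ℂ) * Complex.exp ((θ : ℂ) * Complex.I)) ∂uniformPhase := by
  have hper : Function.Periodic (fun θ => Real.exp (-(2 * ‖y‖ * √inr / v * (1 - Real.cos θ))))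
      (2 * Real.pi) := fun θ => by simp
  rw [ringDensity, scaledBessel, ← integral_uniformPhase_sub hper y.arg, ← integral_const_mul]
  refine integral_congr_ae (ae_of_all _ fun θ => ?_)
  simp only [complexGaussianDensity]
  rw [norm_sub_ring_sq, mul_assoc, ← Real.exp_add]
  congr 2
  ring

theorem measurable_ringDensity (v inr : ℝ) : Measurable (ringDensity v inr) := by
  have := measurable_scaledBessel
  unfold ringDensity
  fun_prop

theorem ringDensity_pos {v : ℝ} (hv : 0 < v) (inr : ℝ) (y : ℂ) : 0 < ringDensity v inr y := by
  have := scaledBessel_pos (s := 2 * ‖y‖ * √inr / v) (by positivity)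
  unfold ringDensity
  positivity

theorem ringDensity_le {v : ℝ} (hv : 0 < v) (inr : ℝ) (y : ℂ) :
    ringDensity v inr y ≤ (Real.pi * v)⁻¹ := by
  have h1 := scaledBessel_le_one (s := 2 * ‖y‖ * √inr / v) (by positivity)
  have h0 := scaledBessel_pos (s := 2 * ‖y‖ * √inr / v) (by positivity)
  have h2 : Real.exp (-((‖y‖ - √inr) ^ 2 / v)) ≤ 1 := by
    rw [Real.exp_le_one_iff, neg_nonpos]
    positivity
  unfold ringDensity
  rw [mul_assoc]
  exact mul_le_of_le_one_right (by positivity) (mul_le_one₀ h2 h0.le h1)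

/-- The exponent is the squared distance to the farthest point of the ring. This Gaussian floor
makes the log density at most quadratic. -/
theorem le_ringDensity {v : ℝ} (hv : 0 < v) (inr : ℝ) (y : ℂ) :
    (Real.pi * v)⁻¹ * Real.exp (-((‖y‖ + √inr) ^ 2 / v)) ≤ ringDensity v inr y := by
  have h1 := exp_neg_two_mul_le_scaledBessel (s := 2 * ‖y‖ * √inr / v) (by positivity)
  unfold ringDensity
  rw [mul_assoc]
  refine mul_le_mul_of_nonneg_left ?_ (by positivity)
  refine le_trans (le_of_eq ?_) (mul_le_mul_of_nonneg_left h1 (Real.exp_nonneg _))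
  rw [← Real.exp_add]
  congr 1
  ring

theorem neg_log_ringDensity {v : ℝ} (hv : 0 < v) (inr : ℝ) (y : ℂ) :
    -Real.log (ringDensity v inr y) = Real.log (Real.pi * v) + (‖y‖ - √inr) ^ 2 / v +
      1 / 2 * Real.log (1 + 2 * ‖y‖ * √inr / v) - logBesselCorrection (2 * ‖y‖ * √inr / v) := by
  have h0 := scaledBessel_pos (s := 2 * ‖y‖ * √inr / v) (by positivity)
  rw [ringDensity, Real.log_mul (by positivity) h0.ne', Real.log_mul (by positivity)
    (by positivity), Real.log_exp, Real.log_inv, logBesselCorrection]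
  ring

theorem abs_log_ringDensity_le {v : ℝ} (hv : 0 < v) (inr : ℝ) (y : ℂ) :
    |Real.log (ringDensity v inr y)| ≤ |Real.log (Real.pi * v)| + (‖y‖ + √inr) ^ 2 / v := by
  have hpos := ringDensity_pos hv inr y
  have h1 := Real.log_le_log hpos (ringDensity_le hv inr y)
  have h2 := Real.log_le_log (by positivity) (le_ringDensity hv inr y)
  rw [Real.log_mul (by positivity) (by positivity), Real.log_exp] at h2
  rw [Real.log_inv] at h1 h2
  have h3 : 0 ≤ (‖y‖ + √inr) ^ 2 / v := by positivity
  rw [abs_le]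
  constructor
  · linarith [le_abs_self (Real.log (Real.pi * v))]
  · linarith [neg_abs_le (Real.log (Real.pi * v))]

theorem measurable_ringMap (inr : ℝ) : Measurable
    (fun p : ℝ × ℂ => (√inr : ℂ) * Complex.exp ((p.1 : ℂ) * Complex.I) + p.2) :=
  Continuous.measurable (by fun_prop)

instance (v : ℝ≥0) (inr : ℝ) : IsProbabilityMeasure (ringLaw v inr) :=
  Measure.isProbabilityMeasure_map (measurable_ringMap inr).aemeasurable

theorem ringLaw_eq_withDensity {v : ℝ≥0} (hv : v ≠ 0) (inr : ℝ) :
    ringLaw v inr = volume.withDensity (fun y => ENNReal.ofReal (ringDensity v inr y)) := by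
  have hv0 : (0 : ℝ) < v := by positivity
  refine Measure.ext_of_lintegral _ fun f hf => ?_
  have hc : Continuous fun p : ℂ × ℝ =>
      p.1 - (√inr : ℂ) * Complex.exp ((p.2 : ℂ) * Complex.I) := by fun_prop
  have hd : Measurable fun p : ℂ × ℝ => complexGaussianDensity v
      (p.1 - (√inr : ℂ) * Complex.exp ((p.2 : ℂ) * Complex.I)) :=
    (measurable_complexGaussianDensity v).comp hc.measurable
  have hof : ∀ y, ENNReal.ofReal (ringDensity v inr y) = ∫⁻ θ, ENNReal.ofReal
      (complexGaussianDensity v (y - (√inr : ℂ) * Complex.exp ((θ : ℂ) * Complex.I)))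
      ∂uniformPhase := by
    intro y
    rw [ringDensity_eq_integral, ofReal_integral_eq_lintegral_ofReal]
    · refine Integrable.of_bound (C := (Real.pi * v)⁻¹)
        (hd.comp (measurable_prodMk_left (x := y))).aestronglyMeasurable (ae_of_all _ fun θ => ?_)
      rw [Real.norm_of_nonneg (complexGaussianDensity_nonneg hv0.le _), complexGaussianDensity]
      refine mul_le_of_le_one_right (by positivity) (Real.exp_le_one_iff.2 ?_)
      rw [neg_nonpos]
      positivity
    · exact ae_of_all _ fun θ => complexGaussianDensity_nonneg hv0.le _
  rw [lintegral_withDensity_eq_lintegral_mul _ (measurable_ringDensity _ _).ennreal_ofReal hf,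
    ringLaw, lintegral_map hf (measurable_ringMap inr),
    lintegral_prod (fun p : ℝ × ℂ => f ((√inr : ℂ) * Complex.exp ((p.1 : ℂ) * Complex.I) + p.2))
      (hf.comp (measurable_ringMap inr)).aemeasurable]
  calc ∫⁻ θ, ∫⁻ z, f ((√inr : ℂ) * Complex.exp ((θ : ℂ) * Complex.I) + z) ∂complexGaussian v
        ∂uniformPhase
      = ∫⁻ θ : ℝ, (∫⁻ y : ℂ, ENNReal.ofReal (complexGaussianDensity v
          (y - (√inr : ℂ) * Complex.exp ((θ : ℂ) * Complex.I))) * f y) ∂uniformPhase := by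
        refine lintegral_congr fun θ => ?_
        rw [lintegral_complexGaussian_eq_lintegral_mul hv
          (f := fun z => f ((√inr : ℂ) * Complex.exp ((θ : ℂ) * Complex.I) + z))
          (hf.comp (measurable_const_add _))]
        refine Eq.trans ?_ (lintegral_add_left_eq_self _
          ((√inr : ℂ) * Complex.exp ((θ : ℂ) * Complex.I)))
        simp
    _ = ∫⁻ y, ∫⁻ θ, ENNReal.ofReal (complexGaussianDensity v
          (y - (√inr : ℂ) * Complex.exp ((θ : ℂ) * Complex.I))) * f y ∂uniformPhase := by
        refine lintegral_lintegral_swap (Measurable.aemeasurable ?_)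
        exact ((hd.comp measurable_swap).ennreal_ofReal).mul (hf.comp measurable_snd)
    _ = _ := by
        refine lintegral_congr fun y => ?_
        rw [Pi.mul_apply, hof]
        exact lintegral_mul_const _ (hd.comp measurable_prodMk_left).ennreal_ofReal

/-! ### Relative entropy through densities and the Gibbs inequality. -/

theorem klDiv_eq_ofReal_integral_log {α : Type*} [MeasurableSpace α] {μ ν : Measure α}
    [IsProbabilityMeasure μ] [IsProbabilityMeasure ν] {g : α → ℝ} (hg : Measurable g)
    (hpos : ∀ a, 0 < g a) (hμ : μ = ν.withDensity (fun a => ENNReal.ofReal (g a)))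
    (hlogint : Integrable (fun a => Real.log (g a)) μ) :
    klDiv μ ν = ENNReal.ofReal (∫ a, Real.log (g a) ∂μ) := by
  have hac : μ ≪ ν := by
    rw [hμ]
    exact withDensity_absolutelyContinuous _ _
  have hllr : llr μ ν =ᵐ[μ] fun a => Real.log (g a) := by
    have h : μ.rnDeriv ν =ᵐ[ν] fun a => ENNReal.ofReal (g a) := by
      conv_lhs => rw [hμ]
      exact Measure.rnDeriv_withDensity ν hg.ennreal_ofReal
    filter_upwards [hac.ae_le h] with a ha
    rw [llr_def]
    simp only [ha, ENNReal.toReal_ofReal (hpos a).le]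
  rw [klDiv_of_ac_of_integrable hac (hlogint.congr hllr.symm), integral_congr_ae hllr]
  simp

/-- The Gibbs inequality, with the cross entropy replaced by an integrable upper bound. -/
theorem neg_integral_log_le_of_density {Ω β : Type*} [MeasurableSpace Ω] [MeasurableSpace β]
    {P : Measure Ω} [IsProbabilityMeasure P] {ν : Measure β} {Y : Ω → β} (hY : Measurable Y)
    {f q : β → ℝ} (hf : Measurable f) (hq : Measurable q) (hf0 : ∀ y, 0 < f y)
    (hq0 : ∀ y, 0 < q y) (hlaw : P.map Y = ν.withDensity (fun y => ENNReal.ofReal (f y)))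
    (hq1 : ∫⁻ y, ENNReal.ofReal (q y) ∂ν ≤ 1)
    (hlogint : Integrable (fun ω => Real.log (f (Y ω))) P) {A : Ω → ℝ} (hA : Integrable A P)
    (hle : ∀ ω, -Real.log (q (Y ω)) ≤ A ω) :
    -∫ ω, Real.log (f (Y ω)) ∂P ≤ ∫ ω, A ω ∂P := by
  have hr : Measurable fun y => q y / f y := hq.div hf
  have hr0 : ∀ y, 0 ≤ q y / f y := fun y => (div_pos (hq0 y) (hf0 y)).le
  have hl : ∫⁻ ω, ENNReal.ofReal (q (Y ω) / f (Y ω)) ∂P ≤ 1 := by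
    rw [← lintegral_map (f := fun y => ENNReal.ofReal (q y / f y)) hr.ennreal_ofReal hY, hlaw,
      lintegral_withDensity_eq_lintegral_mul _ hf.ennreal_ofReal hr.ennreal_ofReal]
    refine le_trans (le_of_eq ?_) hq1
    refine lintegral_congr fun y => ?_
    rw [Pi.mul_apply, ← ENNReal.ofReal_mul (hf0 y).le, mul_div_cancel₀ _ (hf0 y).ne']
  have hri : Integrable (fun ω => q (Y ω) / f (Y ω)) P := by
    refine ⟨(hr.comp hY).aestronglyMeasurable, ?_⟩
    rw [hasFiniteIntegral_iff_ofReal (ae_of_all _ fun ω => hr0 (Y ω))]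
    exact hl.trans_lt ENNReal.one_lt_top
  have hr1 : ∫ ω, q (Y ω) / f (Y ω) ∂P ≤ 1 := by
    rw [integral_eq_lintegral_of_nonneg_ae (ae_of_all _ fun ω => hr0 (Y ω))
      (hr.comp hY).aestronglyMeasurable]
    exact ENNReal.toReal_le_of_le_ofReal zero_le_one (by simpa using hl)
  have hsub : Integrable (fun ω => q (Y ω) / f (Y ω) - 1) P := hri.sub (integrable_const 1)
  -- From log(q/f) ≤ q/f − 1 and −log q ≤ A; only A has to be integrable, never log q along Y.
  have hmono : ∫ ω, -Real.log (f (Y ω)) ∂P ≤ ∫ ω, (A ω + (q (Y ω) / f (Y ω) - 1)) ∂P := by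
    refine integral_mono hlogint.neg (hA.add hsub) fun ω => ?_
    have h1 := Real.log_le_sub_one_of_pos (div_pos (hq0 (Y ω)) (hf0 (Y ω)))
    rw [Real.log_div (hq0 _).ne' (hf0 _).ne'] at h1
    have h2 := hle ω
    simp only
    linarith
  rw [integral_neg, integral_add hA hsub,
    integral_sub hri (integrable_const 1)] at hmono
  simp only [integral_const, probReal_univ, smul_eq_mul, mul_one] at hmono
  linarith

/-! ### Joint law, output density and the formula for the information. -/

/-- The joint law of input, phase and noise. -/
def sourceLaw (F : Measure ℂ) : Measure (ℂ × ℝ × ℂ) :=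
  F.prod (uniformPhase.prod (complexGaussian 1))

instance (F : Measure ℂ) [IsProbabilityMeasure F] : IsProbabilityMeasure (sourceLaw F) := by
  unfold sourceLaw
  infer_instance

/-- The interference plus noise. -/
def disturbance (inr : ℝ) (p : ℂ × ℝ × ℂ) : ℂ :=
  (√inr : ℂ) * Complex.exp ((p.2.1 : ℂ) * Complex.I) + p.2.2

theorem measurable_disturbance (inr : ℝ) : Measurable (disturbance inr) :=
  (measurable_ringMap inr).comp measurable_snd

theorem measurable_inputOutput (inr : ℝ) :
    Measurable (fun p : ℂ × ℝ × ℂ => (p.1, channelOutput inr p.1 p.2.1 p.2.2)) :=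
  measurable_fst.prodMk (measurable_fst.add (measurable_disturbance inr))

instance (F : Measure ℂ) [IsProbabilityMeasure F] (inr : ℝ) :
    IsProbabilityMeasure (inputOutputLaw F inr) :=
  Measure.isProbabilityMeasure_map (μ := sourceLaw F) (measurable_inputOutput inr).aemeasurable

theorem fst_inputOutputLaw (F : Measure ℂ) [IsProbabilityMeasure F] (inr : ℝ) :
    (inputOutputLaw F inr).fst = F := by
  rw [Measure.fst, inputOutputLaw, Measure.map_map measurable_fst (measurable_inputOutput inr)]
  exact measurePreserving_fst.map_eq

theorem snd_inputOutputLaw (F : Measure ℂ) (inr : ℝ) :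
    (inputOutputLaw F inr).snd =
      (sourceLaw F).map (fun p => p.1 + disturbance inr p) := by
  rw [Measure.snd, inputOutputLaw, Measure.map_map measurable_snd (measurable_inputOutput inr)]
  rfl

theorem lintegral_inputOutputLaw (F : Measure ℂ) [IsProbabilityMeasure F] (inr : ℝ)
    {f : ℂ × ℂ → ℝ≥0∞} (hf : Measurable f) :
    ∫⁻ q, f q ∂inputOutputLaw F inr = ∫⁻ x, ∫⁻ w, f (x, x + w) ∂ringLaw 1 inr ∂F := by
  rw [inputOutputLaw, lintegral_map hf (measurable_inputOutput inr),
    lintegral_prod (fun p : ℂ × ℝ × ℂ => f (p.1, channelOutput inr p.1 p.2.1 p.2.2))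
      (hf.comp (measurable_inputOutput inr)).aemeasurable]
  refine lintegral_congr fun x => ?_
  rw [ringLaw, lintegral_map (f := fun w => f (x, x + w)) (hf.comp (by fun_prop))
    (measurable_ringMap inr)]
  rfl

theorem inputOutputLaw_eq_withDensity (F : Measure ℂ) [IsProbabilityMeasure F] (inr : ℝ) :
    inputOutputLaw F inr = (F.prod volume).withDensity
      (fun q => ENNReal.ofReal (ringDensity 1 inr (q.2 - q.1))) := by
  refine Measure.ext_of_lintegral _ fun f hf => ?_
  have hd : Measurable fun q : ℂ × ℂ => ENNReal.ofReal (ringDensity 1 inr (q.2 - q.1)) :=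
    ((measurable_ringDensity 1 inr).comp (by fun_prop)).ennreal_ofReal
  rw [lintegral_inputOutputLaw F inr hf, lintegral_withDensity_eq_lintegral_mul _ hd hf,
    lintegral_prod _ (hd.mul hf).aemeasurable]
  refine lintegral_congr fun x => ?_
  have h : ringLaw 1 inr = volume.withDensity (fun y => ENNReal.ofReal (ringDensity 1 inr y)) := by
    simpa using ringLaw_eq_withDensity one_ne_zero inr
  rw [h, lintegral_withDensity_eq_lintegral_mul _ (measurable_ringDensity _ _).ennreal_ofReal
    (g := fun w => f (x, x + w)) (hf.comp (by fun_prop))]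
  refine Eq.trans ?_ (lintegral_add_left_eq_self _ x)
  simp

/-- The density of the output for the input law `F`. -/
def outputDensity (F : Measure ℂ) (inr : ℝ) (y : ℂ) : ℝ :=
  ∫ x, ringDensity 1 inr (y - x) ∂F

theorem integrable_ringDensity_sub (F : Measure ℂ) [IsProbabilityMeasure F] (inr : ℝ) (y : ℂ) :
    Integrable (fun x => ringDensity 1 inr (y - x)) F := by
  refine Integrable.of_bound (C := (Real.pi * 1)⁻¹)
    ((measurable_ringDensity 1 inr).comp (by fun_prop)).aestronglyMeasurable
    (ae_of_all _ fun x => ?_)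
  rw [Real.norm_of_nonneg (ringDensity_pos one_pos _ _).le]
  exact ringDensity_le one_pos _ _

theorem measurable_outputDensity (F : Measure ℂ) [IsProbabilityMeasure F] (inr : ℝ) :
    Measurable (outputDensity F inr) := by
  refine StronglyMeasurable.measurable ?_
  refine StronglyMeasurable.integral_prod_right (f := fun y x => ringDensity 1 inr (y - x)) ?_
  exact ((measurable_ringDensity 1 inr).comp (by fun_prop)).stronglyMeasurable

theorem snd_inputOutputLaw_eq_withDensity (F : Measure ℂ) [IsProbabilityMeasure F] (inr : ℝ) :
    (inputOutputLaw F inr).snd =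
      volume.withDensity (fun y => ENNReal.ofReal (outputDensity F inr y)) := by
  have hd : Measurable fun q : ℂ × ℂ => ENNReal.ofReal (ringDensity 1 inr (q.2 - q.1)) :=
    ((measurable_ringDensity 1 inr).comp (by fun_prop)).ennreal_ofReal
  refine Measure.ext_of_lintegral _ fun f hf => ?_
  have hfs : Measurable fun q : ℂ × ℂ => f q.2 := hf.comp measurable_snd
  rw [Measure.snd, lintegral_map hf measurable_snd, inputOutputLaw_eq_withDensity,
    lintegral_withDensity_eq_lintegral_mul _ hd hfs, lintegral_prod_symm _ (hd.mul hfs).aemeasurable,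
    lintegral_withDensity_eq_lintegral_mul _ (measurable_outputDensity F inr).ennreal_ofReal hf]
  refine lintegral_congr fun y => ?_
  rw [Pi.mul_apply, outputDensity, ofReal_integral_eq_lintegral_ofReal
    (integrable_ringDensity_sub F inr y) (ae_of_all _ fun x => (ringDensity_pos one_pos _ _).le)]
  have hm : Measurable fun x => ENNReal.ofReal (ringDensity 1 inr (y - x)) :=
    ((measurable_ringDensity 1 inr).comp (by fun_prop)).ennreal_ofReal
  simp only [Pi.mul_apply]
  rw [lintegral_mul_const _ hm]

theorem outputDensity_le (F : Measure ℂ) [IsProbabilityMeasure F] (inr : ℝ) (y : ℂ) :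
    outputDensity F inr y ≤ Real.pi⁻¹ := by
  have h := integral_mono (integrable_ringDensity_sub F inr y) (integrable_const (Real.pi * 1)⁻¹)
    (fun x => ringDensity_le one_pos _ _)
  simpa [outputDensity] using h

/-- Average the floor `le_ringDensity` over the input after separating y from x by (a+b)² ≤ 2a² +
2b². A second moment of the output then suffices for its log density to be integrable. -/
theorem exists_le_outputDensity (F : Measure ℂ) [IsProbabilityMeasure F] (inr : ℝ) :
    ∃ c : ℝ, 0 < c ∧ ∀ y, c * Real.exp (-(2 * ‖y‖ ^ 2)) ≤ outputDensity F inr y := by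
  set g : ℂ → ℝ := fun x => (Real.pi * 1)⁻¹ * Real.exp (-(2 * (‖x‖ + √inr) ^ 2)) with hg
  have hg0 : ∀ x, 0 < g x := fun x => by positivity
  have hgi : Integrable g F := by
    refine Integrable.of_bound (C := (Real.pi * 1)⁻¹)
      (Continuous.aestronglyMeasurable (by fun_prop)) (ae_of_all _ fun x => ?_)
    rw [Real.norm_of_nonneg (hg0 x).le]
    refine mul_le_of_le_one_right (by positivity) (Real.exp_le_one_iff.2 ?_)
    rw [neg_nonpos]
    positivity
  refine ⟨∫ x, g x ∂F, ?_, fun y => ?_⟩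
  · rw [integral_pos_iff_support_of_nonneg (fun x => (hg0 x).le) hgi,
      show Function.support g = Set.univ from Set.eq_univ_of_forall fun x => (hg0 x).ne']
    simp
  · rw [← integral_mul_const]
    refine integral_mono (hgi.mul_const _) (integrable_ringDensity_sub F inr y) fun x => ?_
    refine le_trans ?_ (le_ringDensity one_pos inr (y - x))
    simp only [hg]
    rw [mul_assoc, ← Real.exp_add]
    refine mul_le_mul_of_nonneg_left (Real.exp_le_exp.2 ?_) (by positivity)
    have h1 : ‖y - x‖ + √inr ≤ ‖y‖ + (‖x‖ + √inr) := by linarith [norm_sub_le y x]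
    have h2 : (‖y - x‖ + √inr) ^ 2 ≤ (‖y‖ + (‖x‖ + √inr)) ^ 2 :=
      pow_le_pow_left₀ (by positivity) h1 2
    nlinarith [sq_nonneg (‖y‖ - (‖x‖ + √inr))]

theorem outputDensity_pos (F : Measure ℂ) [IsProbabilityMeasure F] (inr : ℝ) (y : ℂ) :
    0 < outputDensity F inr y := by
  obtain ⟨c, hc, h⟩ := exists_le_outputDensity F inr
  exact (by positivity : 0 < c * Real.exp (-(2 * ‖y‖ ^ 2))).trans_le (h y)

theorem exists_abs_log_outputDensity_le (F : Measure ℂ) [IsProbabilityMeasure F] (inr : ℝ) :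
    ∃ C : ℝ, ∀ y, |Real.log (outputDensity F inr y)| ≤ C + 2 * ‖y‖ ^ 2 := by
  obtain ⟨c, hc, h⟩ := exists_le_outputDensity F inr
  refine ⟨|Real.log c| + |Real.log Real.pi⁻¹|, fun y => ?_⟩
  have h1 := Real.log_le_log (by positivity) (h y)
  rw [Real.log_mul hc.ne' (by positivity), Real.log_exp] at h1
  have h2 := Real.log_le_log (outputDensity_pos F inr y) (outputDensity_le F inr y)
  rw [abs_le]
  constructor
  · linarith [neg_abs_le (Real.log c), abs_nonneg (Real.log Real.pi⁻¹)]
  · linarith [abs_nonneg (Real.log c), le_abs_self (Real.log Real.pi⁻¹), sq_nonneg ‖y‖]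

/-- The joint law has density p(y−x)/f(y) relative to the product of the marginals, p being the ring
density. The output density f is left free: it is `outputDensity` for a general input and a ring
density for a Gaussian one. -/
theorem inputOutputInformation_eq (F : Measure ℂ) [IsProbabilityMeasure F] (inr : ℝ)
    {f : ℂ → ℝ} (hf : Measurable f) (hf0 : ∀ y, 0 < f y)
    (hlaw : (inputOutputLaw F inr).snd = volume.withDensity (fun y => ENNReal.ofReal (f y)))
    (hlogint₁ : Integrable (fun p => Real.log (ringDensity 1 inr (disturbance inr p))) (sourceLaw F))
    (hlogint₂ : Integrable (fun p => Real.log (f (p.1 + disturbance inr p))) (sourceLaw F)) :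
    inputOutputInformation F inr = ENNReal.ofReal
      (∫ p, Real.log (ringDensity 1 inr (disturbance inr p)) ∂sourceLaw F -
        ∫ p, Real.log (f (p.1 + disturbance inr p)) ∂sourceLaw F) := by
  have hd : Measurable fun q : ℂ × ℂ => ringDensity 1 inr (q.2 - q.1) :=
    (measurable_ringDensity 1 inr).comp (by fun_prop)
  have hf2 : Measurable fun q : ℂ × ℂ => f q.2 := hf.comp measurable_snd
  have hg : Measurable fun q : ℂ × ℂ => ringDensity 1 inr (q.2 - q.1) / f q.2 := hd.div hf2
  have hg0 : ∀ q : ℂ × ℂ, 0 < ringDensity 1 inr (q.2 - q.1) / f q.2 := fun q =>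
    div_pos (ringDensity_pos one_pos _ _) (hf0 _)
  have hmeas := measurable_inputOutput inr
  have hlog : ∀ p : ℂ × ℝ × ℂ,
      Real.log (ringDensity 1 inr (channelOutput inr p.1 p.2.1 p.2.2 - p.1) /
        f (channelOutput inr p.1 p.2.1 p.2.2)) =
      Real.log (ringDensity 1 inr (disturbance inr p)) -
        Real.log (f (p.1 + disturbance inr p)) := by
    intro p
    have e : channelOutput inr p.1 p.2.1 p.2.2 = p.1 + disturbance inr p := rfl
    rw [e, add_sub_cancel_left, Real.log_div (ringDensity_pos one_pos _ _).ne' (hf0 _).ne']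
  have hprob : IsProbabilityMeasure (inputOutputLaw F inr).snd := inferInstance
  have hdens : inputOutputLaw F inr = (F.prod (inputOutputLaw F inr).snd).withDensity
      (fun q => ENNReal.ofReal (ringDensity 1 inr (q.2 - q.1) / f q.2)) := by
    rw [hlaw] at hprob ⊢
    rw [prod_withDensity_right hf.ennreal_ofReal,
      ← withDensity_mul _ (hf2.ennreal_ofReal) hg.ennreal_ofReal, inputOutputLaw_eq_withDensity]
    congr 1
    funext q
    rw [Pi.mul_apply, ← ENNReal.ofReal_mul (hf0 _).le, mul_div_cancel₀ _ (hf0 _).ne']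
  have hlogint : Integrable (fun q : ℂ × ℂ => Real.log (ringDensity 1 inr (q.2 - q.1) / f q.2))
      (inputOutputLaw F inr) := by
    rw [inputOutputLaw, integrable_map_measure hg.log.aestronglyMeasurable hmeas.aemeasurable]
    exact (hlogint₁.sub hlogint₂).congr (ae_of_all _ fun p => (hlog p).symm)
  rw [inputOutputInformation, mutualInformation, fst_inputOutputLaw,
    klDiv_eq_ofReal_integral_log hg hg0 hdens hlogint, ← integral_sub hlogint₁ hlogint₂]
  congr 1
  rw [inputOutputLaw, integral_map hmeas.aemeasurable hg.log.aestronglyMeasurable]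
  exact integral_congr_ae (ae_of_all _ hlog)

/-! ### Geometry of a perturbed point on a large ring. -/

/-- The deviation of the modulus of `r * exp (jθ) + u` from the radius `r`. -/
def radialDeviation (r θ : ℝ) (u : ℂ) : ℝ :=
  ‖(r : ℂ) * Complex.exp ((θ : ℂ) * Complex.I) + u‖ - r

/-- The component of `u` in the direction `exp (jθ)`. -/
def radialPart (θ : ℝ) (u : ℂ) : ℝ :=
  u.re * Real.cos θ + u.im * Real.sin θ

theorem continuous_radialPart : Continuous fun p : ℝ × ℂ => radialPart p.1 p.2 := by
  unfold radialPart
  fun_prop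

theorem norm_ring_add (r θ : ℝ) (u : ℂ) :
    ‖(r : ℂ) * Complex.exp ((θ : ℂ) * Complex.I) + u‖ = r + radialDeviation r θ u := by
  rw [radialDeviation]
  ring

theorem radialDeviation_identity (r θ : ℝ) (u : ℂ) :
    2 * r * radialDeviation r θ u + radialDeviation r θ u ^ 2 =
      2 * r * radialPart θ u + ‖u‖ ^ 2 := by
  have h : (r + radialDeviation r θ u) ^ 2 = r ^ 2 + 2 * r * radialPart θ u + ‖u‖ ^ 2 := by
    rw [← norm_ring_add, Complex.sq_norm, Complex.sq_norm, Complex.normSq_apply,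
      Complex.normSq_apply, radialPart]
    simp only [Complex.add_re, Complex.add_im, Complex.re_ofReal_mul, Complex.im_ofReal_mul,
      Complex.exp_ofReal_mul_I_re, Complex.exp_ofReal_mul_I_im]
    linear_combination r ^ 2 * Real.sin_sq_add_cos_sq θ
  linarith

theorem norm_ring {r : ℝ} (hr : 0 ≤ r) (θ : ℝ) :
    ‖(r : ℂ) * Complex.exp ((θ : ℂ) * Complex.I)‖ = r := by
  rw [norm_mul, Complex.norm_exp_ofReal_mul_I, mul_one, Complex.norm_of_nonneg hr]

theorem abs_radialDeviation_le {r : ℝ} (hr : 0 ≤ r) (θ : ℝ) (u : ℂ) :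
    |radialDeviation r θ u| ≤ ‖u‖ := by
  have h := abs_norm_sub_norm_le ((r : ℂ) * Complex.exp ((θ : ℂ) * Complex.I) + u)
    ((r : ℂ) * Complex.exp ((θ : ℂ) * Complex.I))
  rwa [norm_ring hr, add_sub_cancel_left] at h

theorem radialDeviation_add_nonneg (r θ : ℝ) (u : ℂ) : 0 ≤ r + radialDeviation r θ u := by
  rw [← norm_ring_add]
  exact norm_nonneg _

theorem abs_radialPart_le (θ : ℝ) (u : ℂ) : |radialPart θ u| ≤ ‖u‖ := by
  refine abs_le_of_sq_le_sq ?_ (norm_nonneg _)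
  rw [Complex.sq_norm, Complex.normSq_apply, radialPart]
  have h := Real.sin_sq_add_cos_sq θ
  have h2 : u.re * u.re + u.im * u.im - (u.re * Real.cos θ + u.im * Real.sin θ) ^ 2 =
      (u.re * Real.sin θ - u.im * Real.cos θ) ^ 2 := by
    linear_combination -(u.re ^ 2 + u.im ^ 2) * h
  nlinarith [sq_nonneg (u.re * Real.sin θ - u.im * Real.cos θ)]

theorem radialPart_sq_le (θ : ℝ) (u : ℂ) : radialPart θ u ^ 2 ≤ ‖u‖ ^ 2 :=
  sq_le_sq' (abs_le.1 (abs_radialPart_le θ u)).1 (abs_le.1 (abs_radialPart_le θ u)).2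

theorem radialDeviation_sq_le_norm_sq {r : ℝ} (hr : 0 ≤ r) (θ : ℝ) (u : ℂ) :
    radialDeviation r θ u ^ 2 ≤ ‖u‖ ^ 2 :=
  sq_le_sq' (abs_le.1 (abs_radialDeviation_le hr θ u)).1
    (abs_le.1 (abs_radialDeviation_le hr θ u)).2

/-- By `radialDeviation_identity` the difference equals (|u|² − d²)/(2r) with d the deviation, and 0
≤ d² ≤ |u|². -/
theorem abs_radialDeviation_sub_radialPart_le {r : ℝ} (hr : 0 < r) (θ : ℝ) (u : ℂ) :
    |radialDeviation r θ u - radialPart θ u| ≤ ‖u‖ ^ 2 / (2 * r) := by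
  have h1 := radialDeviation_identity r θ u
  have h2 := radialDeviation_sq_le_norm_sq hr.le θ u
  have h3 : 0 ≤ 2 * r * (radialDeviation r θ u - radialPart θ u) := by linarith
  have h4 := nonneg_of_mul_nonneg_right h3 (by positivity)
  rw [abs_of_nonneg h4, le_div_iff₀ (by positivity)]
  nlinarith [sq_nonneg (radialDeviation r θ u)]

theorem radialDeviation_sq_le {r : ℝ} (hr : 0 < r) (θ : ℝ) (u : ℂ) :
    radialDeviation r θ u ^ 2 ≤ radialPart θ u ^ 2 + ‖u‖ ^ 3 / r := by
  have h1 := abs_radialDeviation_sub_radialPart_le hr θ u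
  have h2 : |radialDeviation r θ u + radialPart θ u| ≤ 2 * ‖u‖ :=
    (abs_add_le _ _).trans
      (by linarith [abs_radialDeviation_le hr.le θ u, abs_radialPart_le θ u])
  have h3 : |radialDeviation r θ u - radialPart θ u| * |radialDeviation r θ u + radialPart θ u| ≤
      ‖u‖ ^ 2 / (2 * r) * (2 * ‖u‖) := mul_le_mul h1 h2 (abs_nonneg _) (by positivity)
  rw [← abs_mul] at h3
  have h4 : ‖u‖ ^ 2 / (2 * r) * (2 * ‖u‖) = ‖u‖ ^ 3 / r := by field_simp
  have h5 := le_abs_self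
    ((radialDeviation r θ u - radialPart θ u) * (radialDeviation r θ u + radialPart θ u))
  nlinarith

theorem neg_log_ringDensity_ring_add {v : ℝ} (hv : 0 < v) (inr θ : ℝ) (u : ℂ) :
    -Real.log (ringDensity v inr ((√inr : ℂ) * Complex.exp ((θ : ℂ) * Complex.I) + u)) =
      Real.log (Real.pi * v) + radialDeviation √inr θ u ^ 2 / v +
      1 / 2 * Real.log (1 + 2 / v * √inr * (√inr + radialDeviation √inr θ u)) -
      logBesselCorrection (2 / v * √inr * (√inr + radialDeviation √inr θ u)) := by
  rw [neg_log_ringDensity hv, norm_ring_add]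
  have e : 2 * (√inr + radialDeviation √inr θ u) * √inr / v =
      2 / v * √inr * (√inr + radialDeviation √inr θ u) := by ring
  rw [e]
  congr 4
  ring

/-- This side follows from log x ≤ x − 1 even if the perturbed point is at the origin; the opposite
side does not, and needs 2m ≤ r in the next lemma. -/
theorem log_sub_log_le {c r d m : ℝ} (hc : 0 < c) (hr : 0 < r) (hd : |d| ≤ m) (h0 : 0 ≤ r + d) :
    Real.log (1 + c * r * (r + d)) - Real.log (1 + c * r ^ 2) ≤ m / r := by
  have hm : 0 ≤ m := (abs_nonneg d).trans hd
  have hx : 0 < 1 + c * r * (r + d) := by positivity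
  have hy : 0 < 1 + c * r ^ 2 := by positivity
  rw [← Real.log_div hx.ne' hy.ne']
  refine (Real.log_le_sub_one_of_pos (div_pos hx hy)).trans ?_
  rw [div_sub_one hy.ne', div_le_div_iff₀ hy hr]
  have h1 : c * r ^ 2 * d ≤ c * r ^ 2 * m :=
    mul_le_mul_of_nonneg_left ((le_abs_self d).trans hd) (by positivity)
  nlinarith

theorem abs_log_sub_log_le_of_le {c r d m : ℝ} (hc : 0 < c) (hr : 0 < r) (hd : |d| ≤ m)
    (hm : 2 * m ≤ r) :
    |Real.log (1 + c * r * (r + d)) - Real.log (1 + c * r ^ 2)| ≤ 2 * m / r := by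
  have hm0 : 0 ≤ m := (abs_nonneg d).trans hd
  have hd1 := (abs_le.1 hd).1
  have hrd : r / 2 ≤ r + d := by linarith
  have h0 : 0 < r + d := by linarith
  have hx : 0 < 1 + c * r * (r + d) := by positivity
  have hy : 0 < 1 + c * r ^ 2 := by positivity
  rw [abs_le]
  constructor
  · have h1 : Real.log (1 + c * r ^ 2) - Real.log (1 + c * r * (r + d)) ≤ 2 * m / r := by
      rw [← Real.log_div hy.ne' hx.ne']
      refine (Real.log_le_sub_one_of_pos (div_pos hy hx)).trans ?_
      rw [div_sub_one hx.ne', div_le_div_iff₀ hx hr]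
      have h1 : c * r ^ 2 * (-d) ≤ c * r ^ 2 * m :=
        mul_le_mul_of_nonneg_left (by linarith) (by positivity)
      have h2 : c * r * m * (r / 2) ≤ c * r * m * (r + d) :=
        mul_le_mul_of_nonneg_left hrd (by positivity)
      nlinarith
    linarith
  · refine (log_sub_log_le hc hr hd h0.le).trans ?_
    gcongr
    linarith

/-- A bound free of r, for domination. When r < 2m the logarithm being subtracted is at most c·r² ≤
4c·m². -/
theorem abs_log_sub_log_le {c r d m : ℝ} (hc : 0 < c) (hr : 1 ≤ r) (hd : |d| ≤ m)
    (h0 : 0 ≤ r + d) :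
    |Real.log (1 + c * r * (r + d)) - Real.log (1 + c * r ^ 2)| ≤ 2 * m + 4 * c * m ^ 2 := by
  have hr0 : 0 < r := by linarith
  have hm0 : 0 ≤ m := (abs_nonneg d).trans hd
  have hsq : 0 ≤ 4 * c * m ^ 2 := by positivity
  rcases le_total (2 * m) r with h | h
  · refine (abs_log_sub_log_le_of_le hc hr0 hd h).trans ?_
    have : 2 * m / r ≤ 2 * m := div_le_self (by linarith) hr
    linarith
  · rw [abs_le]
    constructor
    · have h1 : 0 ≤ Real.log (1 + c * r * (r + d)) := Real.log_nonneg (by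
        have : 0 ≤ c * r * (r + d) := by positivity
        linarith)
      have h2 := Real.log_le_sub_one_of_pos (show 0 < 1 + c * r ^ 2 by positivity)
      have h3 : c * r ^ 2 ≤ c * (2 * m) ^ 2 :=
        mul_le_mul_of_nonneg_left (pow_le_pow_left₀ hr0.le h 2) hc.le
      nlinarith
    · refine (log_sub_log_le hc hr0 hd h0).trans ?_
      have : m / r ≤ m := div_le_self hm0 hr
      linarith

/-! ### Phase averages and the entropy of a large ring. -/

open Real in
theorem integral_cos_sq_uniformPhase : ∫ θ, cos θ ^ 2 ∂uniformPhase = 1 / 2 := by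
  rw [integral_uniformPhase, integral_cos_sq]
  simp
  field_simp

open Real in
theorem integral_sin_sq_uniformPhase : ∫ θ, sin θ ^ 2 ∂uniformPhase = 1 / 2 := by
  rw [integral_uniformPhase, integral_sin_sq]
  simp
  field_simp

open Real in
theorem integral_sin_mul_cos_uniformPhase : ∫ θ, sin θ * cos θ ∂uniformPhase = 0 := by
  rw [integral_uniformPhase, integral_sin_mul_cos₁]
  simp

theorem integrable_uniformPhase_of_bounded {f : ℝ → ℝ} (hf : Continuous f) {C : ℝ}
    (hC : ∀ θ, |f θ| ≤ C) : Integrable f uniformPhase :=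
  Integrable.of_bound hf.aestronglyMeasurable C (ae_of_all _ hC)

/-- A uniform direction sees half of the power, as the cross term sin θ cos θ averages to zero. -/
theorem integral_radialPart_sq (u : ℂ) :
    ∫ θ, radialPart θ u ^ 2 ∂uniformPhase = ‖u‖ ^ 2 / 2 := by
  have e : ∀ θ, radialPart θ u ^ 2 = u.re ^ 2 * Real.cos θ ^ 2 + u.im ^ 2 * Real.sin θ ^ 2 +
      2 * u.re * u.im * (Real.sin θ * Real.cos θ) := fun θ => by
    rw [radialPart]
    ring
  have h1 : Integrable (fun θ => Real.cos θ ^ 2) uniformPhase :=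
    integrable_uniformPhase_of_bounded (by fun_prop) (C := 1) fun θ => by
      rw [abs_of_nonneg (sq_nonneg _)]
      exact Real.cos_sq_le_one θ
  have h2 : Integrable (fun θ => Real.sin θ ^ 2) uniformPhase :=
    integrable_uniformPhase_of_bounded (by fun_prop) (C := 1) fun θ => by
      rw [abs_of_nonneg (sq_nonneg _)]
      exact Real.sin_sq_le_one θ
  have h3 : Integrable (fun θ => Real.sin θ * Real.cos θ) uniformPhase :=
    integrable_uniformPhase_of_bounded (by fun_prop) (C := 1) fun θ => by
      rw [abs_mul]
      exact mul_le_one₀ (Real.abs_sin_le_one θ) (abs_nonneg _) (Real.abs_cos_le_one θ)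
  simp_rw [e]
  rw [integral_add ((h1.const_mul _).fun_add (h2.const_mul _)) (h3.const_mul _),
    integral_add (h1.const_mul _) (h2.const_mul _), integral_const_mul, integral_const_mul,
    integral_const_mul, integral_cos_sq_uniformPhase, integral_sin_sq_uniformPhase,
    integral_sin_mul_cos_uniformPhase, Complex.sq_norm, Complex.normSq_apply]
  ring

theorem integrable_radialPart_sq (v : ℝ≥0) :
    Integrable (fun p : ℝ × ℂ => radialPart p.1 p.2 ^ 2) (uniformPhase.prod (complexGaussian v)) := by
  refine ((integrable_norm_pow_complexGaussian v 2).comp_snd uniformPhase).mono'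
    (continuous_radialPart.pow 2).aestronglyMeasurable (ae_of_all _ fun p => ?_)
  rw [Real.norm_of_nonneg (sq_nonneg _)]
  exact radialPart_sq_le _ _

theorem integral_radialPart_sq_complexGaussian (v : ℝ≥0) :
    ∫ p, radialPart p.1 p.2 ^ 2 ∂uniformPhase.prod (complexGaussian v) = v / 2 := by
  rw [integral_prod_symm _ (integrable_radialPart_sq v)]
  simp_rw [integral_radialPart_sq]
  rw [integral_div, integral_norm_sq_complexGaussian]

/-- The differential entropy of `ringLaw v inr`. -/
def ringEntropy (v : ℝ≥0) (inr : ℝ) : ℝ :=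
  ∫ p : ℝ × ℂ, -Real.log (ringDensity v inr
    ((√inr : ℂ) * Complex.exp ((p.1 : ℂ) * Complex.I) + p.2)) ∂uniformPhase.prod (complexGaussian v)

theorem ringEntropy_zero {v : ℝ≥0} (hv : v ≠ 0) :
    ringEntropy v 0 = Real.log (Real.pi * v) + 1 := by
  have hv0 : (0 : ℝ) < v := by positivity
  rw [ringEntropy]
  have e : ∀ p : ℝ × ℂ, -Real.log (ringDensity v 0
      ((√(0 : ℝ) : ℂ) * Complex.exp ((p.1 : ℂ) * Complex.I) + p.2)) =
      Real.log (Real.pi * v) + ‖p.2‖ ^ 2 / v := fun p => by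
    rw [neg_log_ringDensity hv0]
    simp [logBesselCorrection_zero]
  have hi := (integrable_norm_pow_complexGaussian v 2).comp_snd uniformPhase
  simp_rw [e]
  rw [integral_add (integrable_const _) (hi.div_const _), integral_div,
    integral_fun_snd (fun z : ℂ => ‖z‖ ^ 2), integral_norm_sq_complexGaussian]
  simp [hv0.ne']

theorem measurable_log_ringDensity_ring (v inr : ℝ) :
    Measurable (fun p : ℝ × ℂ => Real.log (ringDensity v inr
      ((√inr : ℂ) * Complex.exp ((p.1 : ℂ) * Complex.I) + p.2))) :=
  ((measurable_ringDensity v inr).comp (measurable_ringMap inr)).log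

theorem integrable_log_ringDensity {Ω : Type*} [MeasurableSpace Ω] {P : Measure Ω}
    [IsProbabilityMeasure P] {v : ℝ} (hv : 0 < v) (inr : ℝ) {Y : Ω → ℂ} (hY : Measurable Y)
    (hY2 : Integrable (fun ω => ‖Y ω‖ ^ 2) P) :
    Integrable (fun ω => Real.log (ringDensity v inr (Y ω))) P := by
  refine ((integrable_const (|Real.log (Real.pi * v)| + 2 * √inr ^ 2 / v)).add
    (hY2.const_mul (2 / v))).mono' ((measurable_ringDensity v inr).comp hY).log.aestronglyMeasurable
    (ae_of_all _ fun ω => ?_)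
  refine (abs_log_ringDensity_le hv inr (Y ω)).trans ?_
  have h : (‖Y ω‖ + √inr) ^ 2 / v ≤ 2 * √inr ^ 2 / v + 2 / v * ‖Y ω‖ ^ 2 := by
    rw [show 2 * √inr ^ 2 / v + 2 / v * ‖Y ω‖ ^ 2 = (2 * √inr ^ 2 + 2 * ‖Y ω‖ ^ 2) / v by ring]
    gcongr
    nlinarith [sq_nonneg (‖Y ω‖ - √inr)]
  simp only [Pi.add_apply]
  linarith

theorem integrable_norm_sq_ring_add {Ω : Type*} [MeasurableSpace Ω] {P : Measure Ω}
    [IsProbabilityMeasure P] (r : ℝ) {Θ : Ω → ℝ} {U : Ω → ℂ} (hΘ : Measurable Θ)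
    (hU : Measurable U) (hU2 : Integrable (fun ω => ‖U ω‖ ^ 2) P) :
    Integrable (fun ω => ‖(r : ℂ) * Complex.exp ((Θ ω : ℂ) * Complex.I) + U ω‖ ^ 2) P := by
  have hm : Measurable fun ω => (r : ℂ) * Complex.exp ((Θ ω : ℂ) * Complex.I) + U ω := by
    fun_prop
  refine ((integrable_const (2 * r ^ 2)).add (hU2.const_mul 2)).mono'
    (hm.norm.pow_const 2).aestronglyMeasurable (ae_of_all _ fun ω => ?_)
  rw [Real.norm_of_nonneg (by positivity)]
  have h1 : ‖(r : ℂ) * Complex.exp ((Θ ω : ℂ) * Complex.I)‖ = |r| := by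
    rw [norm_mul, Complex.norm_exp_ofReal_mul_I, mul_one, Complex.norm_real, Real.norm_eq_abs]
  have h2 := norm_add_le ((r : ℂ) * Complex.exp ((Θ ω : ℂ) * Complex.I)) (U ω)
  rw [h1] at h2
  have h3 := pow_le_pow_left₀ (norm_nonneg _) h2 2
  simp only [Pi.add_apply]
  nlinarith [sq_nonneg (|r| - ‖U ω‖), sq_abs r]

/-- Pointwise, the deviation tends to the radial part, the Bessel argument tends to infinity, and
replacing it by 2r²/v inside the logarithm costs o(1). -/
theorem tendsto_neg_log_ringDensity_sub {v : ℝ} (hv : 0 < v) (θ : ℝ) (u : ℂ) :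
    Tendsto (fun inr : ℝ => -Real.log (ringDensity v inr
        ((√inr : ℂ) * Complex.exp ((θ : ℂ) * Complex.I) + u)) -
        1 / 2 * Real.log (1 + 2 / v * √inr ^ 2)) atTop
      (𝓝 (Real.log (Real.pi * v) + radialPart θ u ^ 2 / v - Real.log (√(2 * Real.pi))⁻¹)) := by
  have hsqrt : Tendsto (fun inr : ℝ => √inr) atTop atTop := Real.tendsto_sqrt_atTop
  have hc : 0 < 2 / v := by positivity
  have hdev : Tendsto (fun inr : ℝ => radialDeviation √inr θ u) atTop (𝓝 (radialPart θ u)) := by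
    rw [tendsto_iff_dist_tendsto_zero]
    have h0 : Tendsto (fun inr : ℝ => ‖u‖ ^ 2 / (2 * √inr)) atTop (𝓝 0) :=
      (hsqrt.const_mul_atTop two_pos).const_div_atTop _
    refine squeeze_zero' (Eventually.of_forall fun _ => dist_nonneg) ?_ h0
    filter_upwards [hsqrt.eventually_gt_atTop 0] with inr h
    exact abs_radialDeviation_sub_radialPart_le h θ u
  have hlog : Tendsto (fun inr : ℝ =>
      Real.log (1 + 2 / v * √inr * (√inr + radialDeviation √inr θ u)) -
        Real.log (1 + 2 / v * √inr ^ 2)) atTop (𝓝 0) := by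
    have h0 : Tendsto (fun inr : ℝ => 2 * ‖u‖ / √inr) atTop (𝓝 0) := hsqrt.const_div_atTop _
    refine squeeze_zero_norm' ?_ h0
    filter_upwards [hsqrt.eventually_gt_atTop 0, hsqrt.eventually_ge_atTop (2 * ‖u‖)] with inr h h'
    exact abs_log_sub_log_le_of_le hc h (abs_radialDeviation_le h.le θ u) h'
  have harg : Tendsto (fun inr : ℝ => 2 / v * √inr * (√inr + radialDeviation √inr θ u))
      atTop atTop :=
    (hsqrt.const_mul_atTop hc).atTop_mul_atTop₀ (hsqrt.atTop_add hdev)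
  have hK := tendsto_logBesselCorrection.comp harg
  have hall := (((hdev.pow 2).div_const v).const_add (Real.log (Real.pi * v))).add
    ((hlog.const_mul (1 / 2)).sub hK)
  refine (hall.congr fun inr => ?_).trans (le_of_eq ?_)
  · rw [neg_log_ringDensity_ring_add hv]
    simp only [Function.comp_apply]
    ring
  · congr 1
    ring

theorem tendsto_ringEntropy {v : ℝ≥0} (hv : v ≠ 0) :
    Tendsto (fun inr : ℝ => ringEntropy v inr - 1 / 2 * Real.log (1 + 2 / v * √inr ^ 2)) atTop
      (𝓝 (Real.log (Real.pi * v) + 1 / 2 - Real.log (√(2 * Real.pi))⁻¹)) := by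
  have hv0 : (0 : ℝ) < v := by positivity
  have hc : (0 : ℝ) < 2 / v := by positivity
  obtain ⟨B, hB0, hB⟩ := exists_abs_logBesselCorrection_le
  set N := uniformPhase.prod (complexGaussian v) with hN
  have hn : ∀ n : ℕ, Integrable (fun p : ℝ × ℂ => ‖p.2‖ ^ n) N := fun n =>
    (integrable_norm_pow_complexGaussian v n).comp_snd uniformPhase
  have hn1 : Integrable (fun p : ℝ × ℂ => ‖p.2‖) N := by simpa using hn 1
  have hlogint : ∀ inr : ℝ, Integrable (fun p : ℝ × ℂ => Real.log (ringDensity v inr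
      ((√inr : ℂ) * Complex.exp ((p.1 : ℂ) * Complex.I) + p.2))) N := fun inr =>
    integrable_log_ringDensity hv0 inr (measurable_ringMap inr)
      (integrable_norm_sq_ring_add _ measurable_fst measurable_snd (hn 2))
  have hlim : Tendsto (fun inr : ℝ => ∫ p : ℝ × ℂ, (-Real.log (ringDensity v inr
        ((√inr : ℂ) * Complex.exp ((p.1 : ℂ) * Complex.I) + p.2)) -
        1 / 2 * Real.log (1 + 2 / v * √inr ^ 2)) ∂N) atTop
      (𝓝 (∫ p : ℝ × ℂ, (Real.log (Real.pi * v) + radialPart p.1 p.2 ^ 2 / v -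
        Real.log (√(2 * Real.pi))⁻¹) ∂N)) := by
    refine tendsto_integral_filter_of_dominated_convergence
      -- The terms |u| and 4|u|²/v are half the bound of `abs_log_sub_log_le` at c = 2/v; |u|²/v
      -- bounds the squared deviation.
      (fun p => |Real.log (Real.pi * v)| + B + (‖p.2‖ + (1 / v + 4 / v) * ‖p.2‖ ^ 2)) ?_ ?_ ?_ ?_
    · exact Eventually.of_forall fun inr =>
        ((measurable_log_ringDensity_ring v inr).neg.sub_const _).aestronglyMeasurable
    · filter_upwards [Real.tendsto_sqrt_atTop.eventually_ge_atTop 1] with inr hr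
      refine ae_of_all _ fun p => ?_
      have hr0 : 0 < √inr := by linarith
      have hadd := radialDeviation_add_nonneg √inr p.1 p.2
      have h1 := abs_log_sub_log_le hc hr (abs_radialDeviation_le hr0.le p.1 p.2) hadd
      have h2 := hB (2 / v * √inr * (√inr + radialDeviation √inr p.1 p.2)) (by positivity)
      have h3 : radialDeviation √inr p.1 p.2 ^ 2 / v ≤ ‖p.2‖ ^ 2 / v := by
        exact div_le_div_of_nonneg_right (radialDeviation_sq_le_norm_sq hr0.le p.1 p.2) hv0.le
      have h4 : 0 ≤ radialDeviation √inr p.1 p.2 ^ 2 / v := by positivity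
      have e1 : (1 / (v : ℝ) + 4 / v) * ‖p.2‖ ^ 2 =
          ‖p.2‖ ^ 2 / v + 1 / 2 * (4 * (2 / v) * ‖p.2‖ ^ 2) := by ring
      rw [neg_log_ringDensity_ring_add hv0, Real.norm_eq_abs, abs_le, e1]
      rw [abs_le] at h1 h2
      have h5 : 0 ≤ ‖p.2‖ ^ 2 / (v : ℝ) := by positivity
      constructor
      · linarith [neg_abs_le (Real.log (Real.pi * v))]
      · linarith [le_abs_self (Real.log (Real.pi * v))]
    · exact (integrable_const _).add (hn1.add ((hn 2).const_mul _))
    · exact ae_of_all _ fun p => tendsto_neg_log_ringDensity_sub hv0 p.1 p.2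
  have e1 : ∫ p : ℝ × ℂ, (Real.log (Real.pi * v) + radialPart p.1 p.2 ^ 2 / v -
        Real.log (√(2 * Real.pi))⁻¹) ∂N =
      Real.log (Real.pi * v) + 1 / 2 - Real.log (√(2 * Real.pi))⁻¹ := by
    have hi : Integrable (fun p : ℝ × ℂ => radialPart p.1 p.2 ^ 2 / (v : ℝ)) N :=
      (integrable_radialPart_sq v).div_const _
    rw [integral_sub ((integrable_const _).fun_add hi) (integrable_const _),
      integral_add (integrable_const _) hi, integral_div, integral_radialPart_sq_complexGaussian]
    simp only [integral_const, probReal_univ, smul_eq_mul, one_mul]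
    field_simp
  rw [e1] at hlim
  refine hlim.congr fun inr => ?_
  rw [integral_sub (hlogint inr).fun_neg (integrable_const _)]
  simp [ringEntropy, hN]

/-! ### Pointwise bounds on the test density, uniform in the input. -/

theorem log_inv_sqrt_two_pi_nonpos : Real.log (√(2 * Real.pi))⁻¹ ≤ 0 := by
  refine Real.log_nonpos (by positivity) (inv_le_one_of_one_le₀ ?_)
  rw [Real.one_le_sqrt]
  linarith [Real.pi_gt_three]

/-- A Bessel argument below the threshold A forces r ≤ 2m: otherwise it would exceed r²/v ≥ A. The
bounded loss B + |κ| is then at most 4(B + |κ|)m²/r². -/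
theorem logBesselCorrection_lower_bound {v δ : ℝ} (hv : 0 < v) (hδ : 0 < δ) :
    ∃ C : ℝ, 0 ≤ C ∧ ∀ᶠ r : ℝ in atTop, ∀ d m : ℝ, |d| ≤ m → 0 ≤ r + d →
      Real.log (√(2 * Real.pi))⁻¹ - δ - C * m ^ 2 / r ^ 2 ≤
        logBesselCorrection (2 / v * r * (r + d)) := by
  set κ := Real.log (√(2 * Real.pi))⁻¹
  obtain ⟨B, hB0, hB⟩ := exists_abs_logBesselCorrection_le
  obtain ⟨A, hA⟩ := eventually_atTop.1 (tendsto_logBesselCorrection.eventually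
    (Metric.ball_mem_nhds κ hδ))
  refine ⟨4 * (B + |κ|), by positivity, ?_⟩
  filter_upwards [eventually_ge_atTop 1, eventually_ge_atTop (A * v)] with r hr hrA d m hd h0
  have hr0 : 0 < r := by linarith
  have hm0 : 0 ≤ m := (abs_nonneg d).trans hd
  have hC : 0 ≤ 4 * (B + |κ|) * m ^ 2 / r ^ 2 := by positivity
  rcases le_total A (2 / v * r * (r + d)) with h | h
  · have h1 := hA _ h
    rw [Real.dist_eq, abs_lt] at h1
    linarith [h1.1]
  · have hs : 0 ≤ 2 / v * r * (r + d) := by positivity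
    have h1 := (abs_le.1 (hB _ hs)).1
    have h2 : r ≤ 2 * m := by
      by_contra hlt
      push Not at hlt
      have h3 : r / 2 < r + d := by linarith [(abs_le.1 hd).1]
      have h4 : 2 / v * r * (r / 2) < A := lt_of_lt_of_le (by gcongr) h
      have h5 : 2 / v * r * (r / 2) = r ^ 2 / v := by ring
      rw [h5, div_lt_iff₀ hv] at h4
      nlinarith
    have h3 : 1 ≤ 4 * m ^ 2 / r ^ 2 := by
      rw [one_le_div (by positivity)]
      nlinarith
    have h4 : B + |κ| ≤ 4 * (B + |κ|) * m ^ 2 / r ^ 2 := by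
      rw [show 4 * (B + |κ|) * m ^ 2 / r ^ 2 = (B + |κ|) * (4 * m ^ 2 / r ^ 2) by ring]
      exact le_mul_of_one_le_right (by positivity) h3
    linarith [le_abs_self κ]

/-- Here t is the fourth root of the interference power, so r = t². The truncation a ≤ t trades a³
for a²t, leaving errors of order 1/t with only a second moment in a. -/
theorem moment_error_le {t C a b m : ℝ} (ht : 1 ≤ t) (hC : 0 ≤ C) (ha : 0 ≤ a) (hb : 0 ≤ b)
    (hm : 0 ≤ m) (hmab : m ≤ a + b) (hat : a ≤ t) :
    m ^ 3 / t ^ 2 + 1 / 2 * (m / t ^ 2) + C * m ^ 2 / (t ^ 2) ^ 2 ≤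
      (5 + 2 * C) / t * (1 + a ^ 2 + b ^ 2 + b ^ 3) := by
  have ht0 : 0 < t := by linarith
  have h2 : m ^ 2 ≤ 2 * a ^ 2 + 2 * b ^ 2 :=
    (pow_le_pow_left₀ hm hmab 2).trans (by nlinarith [sq_nonneg (a - b)])
  have h3 : m ^ 3 ≤ 4 * (a ^ 3 + b ^ 3) := by
    refine (pow_le_pow_left₀ hm hmab 3).trans ?_
    have := add_pow_le ha hb 3
    norm_num at this
    exact this
  have ha3 : a ^ 3 ≤ a ^ 2 * t := by nlinarith [sq_nonneg a]
  have hb3 : 0 ≤ b ^ 3 := by positivity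
  have ht2 : t ≤ t ^ 2 := by nlinarith
  have ht4 : t ≤ (t ^ 2) ^ 2 := by nlinarith
  have e1 : m ^ 3 / t ^ 2 ≤ 4 * (a ^ 2 + b ^ 3) / t := by
    rw [div_le_div_iff₀ (by positivity) ht0]
    have : m ^ 3 ≤ 4 * (a ^ 2 + b ^ 3) * t := by nlinarith
    calc m ^ 3 * t ≤ 4 * (a ^ 2 + b ^ 3) * t * t := by gcongr
      _ = 4 * (a ^ 2 + b ^ 3) * t ^ 2 := by ring
  have e2 : m / t ^ 2 ≤ (1 + a ^ 2 + b ^ 2) / t := by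
    have hm1 : m ≤ 1 + a ^ 2 + b ^ 2 := by nlinarith [sq_nonneg (m - 1)]
    exact div_le_div₀ (by positivity) hm1 ht0 ht2
  have e3 : C * m ^ 2 / (t ^ 2) ^ 2 ≤ C * (2 * a ^ 2 + 2 * b ^ 2) / t :=
    div_le_div₀ (by positivity) (by gcongr) ht0 ht4
  have e4 : 4 * (a ^ 2 + b ^ 3) / t + 1 / 2 * ((1 + a ^ 2 + b ^ 2) / t) +
      C * (2 * a ^ 2 + 2 * b ^ 2) / t ≤ (5 + 2 * C) / t * (1 + a ^ 2 + b ^ 2 + b ^ 3) := by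
    rw [show 4 * (a ^ 2 + b ^ 3) / t + 1 / 2 * ((1 + a ^ 2 + b ^ 2) / t) +
      C * (2 * a ^ 2 + 2 * b ^ 2) / t = (4 * (a ^ 2 + b ^ 3) + 1 / 2 * (1 + a ^ 2 + b ^ 2) +
      C * (2 * a ^ 2 + 2 * b ^ 2)) / t by ring,
      show (5 + 2 * C) / t * (1 + a ^ 2 + b ^ 2 + b ^ 3) =
        (5 + 2 * C) * (1 + a ^ 2 + b ^ 2 + b ^ 3) / t by ring]
    refine div_le_div_of_nonneg_right ?_ ht0.le
    nlinarith [mul_nonneg hC hb3, sq_nonneg a, sq_nonneg b]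
  linarith

/-- The leading term of the cross entropy relative to `ringLaw v inr`. -/
def ringConstant (v inr : ℝ) : ℝ :=
  Real.log (Real.pi * v) + 1 / 2 * Real.log (1 + 2 / v * √inr ^ 2) -
    Real.log (√(2 * Real.pi))⁻¹

/-- The hypothesis 1 ≤ v serves to drop the factor 1/v from the cubic error. -/
theorem eventually_neg_log_ringDensity_le {v η : ℝ} (hv : 1 ≤ v) (hη : 0 < η) :
    ∀ᶠ inr : ℝ in atTop, ∀ (θ : ℝ) (x z : ℂ), ‖x‖ ^ 2 ≤ √inr →
      -Real.log (ringDensity v inr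
        ((√inr : ℂ) * Complex.exp ((θ : ℂ) * Complex.I) + (x + z))) ≤
      ringConstant v inr + radialPart θ (x + z) ^ 2 / v +
        η * (1 + ‖x‖ ^ 2 + ‖z‖ ^ 2 + ‖z‖ ^ 3) := by
  have hv0 : 0 < v := by linarith
  obtain ⟨C, hC0, hC⟩ := logBesselCorrection_lower_bound hv0 (half_pos hη)
  have hsqrt := Real.tendsto_sqrt_atTop
  have hsmall : Tendsto (fun inr : ℝ => (5 + 2 * C) / √√inr) atTop (𝓝 0) :=
    (hsqrt.comp hsqrt).const_div_atTop _
  filter_upwards [hsqrt.eventually hC, hsqrt.eventually_ge_atTop 1,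
    hsmall.eventually (ge_mem_nhds (half_pos hη))] with inr hK hr hsm θ x z hx
  have hr0 : 0 < √inr := by linarith
  have ht : 1 ≤ √√inr := Real.one_le_sqrt.2 hr
  have hsq : √√inr ^ 2 = √inr := Real.sq_sqrt hr0.le
  have hd := abs_radialDeviation_le hr0.le θ (x + z)
  have hadd := radialDeviation_add_nonneg √inr θ (x + z)
  have h1 := hK _ _ hd hadd
  have h2 := log_sub_log_le (c := 2 / v) (by positivity) hr0 hd hadd
  have h3 : radialDeviation √inr θ (x + z) ^ 2 / v ≤
      radialPart θ (x + z) ^ 2 / v + ‖x + z‖ ^ 3 / √inr := by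
    have := div_le_div_of_nonneg_right (radialDeviation_sq_le hr0 θ (x + z)) hv0.le
    rw [add_div] at this
    exact this.trans (add_le_add_right (div_le_self (by positivity) hv) _)
  have h4 := moment_error_le (C := C) ht hC0 (norm_nonneg x) (norm_nonneg z)
    (norm_nonneg (x + z)) (norm_add_le x z) (Real.le_sqrt_of_sq_le hx)
  rw [hsq] at h4
  set Q := 1 + ‖x‖ ^ 2 + ‖z‖ ^ 2 + ‖z‖ ^ 3 with hQ
  have hQ1 : 1 ≤ Q := by
    have : 0 ≤ ‖x‖ ^ 2 + ‖z‖ ^ 2 + ‖z‖ ^ 3 := by positivity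
    linarith
  have h5 : (5 + 2 * C) / √√inr * Q ≤ η / 2 * Q := by gcongr
  have h6 : η / 2 ≤ η / 2 * Q := le_mul_of_one_le_right (by positivity) hQ1
  rw [neg_log_ringDensity_ring_add hv0, ringConstant]
  linarith

theorem complexGaussianDensity_pos {v : ℝ} (hv : 0 < v) (z : ℂ) :
    0 < complexGaussianDensity v z := by
  unfold complexGaussianDensity
  positivity

theorem neg_log_complexGaussianDensity {v : ℝ} (hv : 0 < v) (z : ℂ) :
    -Real.log (complexGaussianDensity v z) = Real.log (Real.pi * v) + ‖z‖ ^ 2 / v := by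
  rw [complexGaussianDensity, Real.log_mul (by positivity) (by positivity), Real.log_exp,
    Real.log_inv]
  ring

theorem eventually_log_one_add_le_sqrt {ε : ℝ} (hε : 0 < ε) :
    ∀ᶠ t : ℝ in atTop, Real.log (1 + t) ≤ ε * √t := by
  have h := (isLittleO_log_rpow_atTop (r := 1 / 2) (by norm_num)).bound (half_pos hε)
  have h' := (tendsto_atTop_add_const_left atTop (1 : ℝ) tendsto_id).eventually h
  filter_upwards [h', eventually_ge_atTop 1] with t ht ht1
  have hpos : 0 ≤ t := by linarith
  simp only [id_eq] at ht
  rw [← Real.sqrt_eq_rpow, Real.norm_of_nonneg (Real.sqrt_nonneg _)] at ht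
  have h1 : √(1 + t) ≤ 2 * √t := by
    rw [Real.sqrt_le_left (by positivity), mul_pow, Real.sq_sqrt hpos]
    linarith
  have h2 := mul_le_mul_of_nonneg_left h1 (half_pos hε).le
  linarith [Real.le_norm_self (Real.log (1 + t))]

theorem eventually_neg_log_complexGaussianDensity_le {η : ℝ} (hη : 0 < η) :
    ∀ᶠ inr : ℝ in atTop, ∀ (θ : ℝ) (x z : ℂ), √inr ≤ ‖x‖ ^ 2 →
      Real.log (1 + inr) - Real.log (complexGaussianDensity (1 + inr)
        ((√inr : ℂ) * Complex.exp ((θ : ℂ) * Complex.I) + (x + z))) ≤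
      Real.log Real.pi + η * (1 + ‖x‖ ^ 2 + ‖z‖ ^ 2 + ‖z‖ ^ 3) := by
  have hsqrt := Real.tendsto_sqrt_atTop
  -- Budget: two logarithms at η/8 each, η/4 for the constant 3 (from √I ≥ 12/η) and η/4 for the
  -- quadratic term (from I ≥ 12/η), all within η.
  filter_upwards [eventually_log_one_add_le_sqrt (show 0 < η / 8 by positivity),
    hsqrt.eventually_ge_atTop (12 / η), eventually_ge_atTop (12 / η), eventually_ge_atTop 1]
    with inr hlog hbig hbig' h1 θ x z hx
  have h0 : 0 ≤ inr := by linarith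
  have hpos : 0 < 1 + inr := by linarith
  have hn : ‖(√inr : ℂ) * Complex.exp ((θ : ℂ) * Complex.I) + (x + z)‖ ≤
      √inr + (‖x‖ + ‖z‖) := by
    refine (norm_add_le _ _).trans ?_
    rw [norm_ring (Real.sqrt_nonneg _)]
    gcongr
    exact norm_add_le x z
  have hn2 : ‖(√inr : ℂ) * Complex.exp ((θ : ℂ) * Complex.I) + (x + z)‖ ^ 2 ≤
      3 * (1 + inr) + 3 * (‖x‖ ^ 2 + ‖z‖ ^ 2) := by
    refine (pow_le_pow_left₀ (norm_nonneg _) hn 2).trans ?_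
    nlinarith [Real.sq_sqrt h0, sq_nonneg (√inr - ‖x‖), sq_nonneg (√inr - ‖z‖),
      sq_nonneg (‖x‖ - ‖z‖)]
  have hn3 : ‖(√inr : ℂ) * Complex.exp ((θ : ℂ) * Complex.I) + (x + z)‖ ^ 2 / (1 + inr) ≤
      3 + η / 4 * (‖x‖ ^ 2 + ‖z‖ ^ 2) := by
    rw [div_le_iff₀ hpos]
    rw [div_le_iff₀ hη] at hbig'
    nlinarith [mul_nonneg (show 0 ≤ (1 + inr) * η / 4 - 3 by nlinarith)
      (show 0 ≤ ‖x‖ ^ 2 + ‖z‖ ^ 2 by positivity)]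
  have h3 : 3 ≤ η / 4 * ‖x‖ ^ 2 := by
    have := hbig.trans hx
    rw [div_le_iff₀ hη] at this
    linarith
  have h4 : Real.log (1 + inr) ≤ η / 8 * ‖x‖ ^ 2 :=
    hlog.trans (mul_le_mul_of_nonneg_left hx (by positivity))
  have h5 := neg_log_complexGaussianDensity hpos
    ((√inr : ℂ) * Complex.exp ((θ : ℂ) * Complex.I) + (x + z))
  rw [Real.log_mul Real.pi_pos.ne' hpos.ne'] at h5
  have h6 : 0 ≤ η * ‖z‖ ^ 2 := by positivity
  have h7 : 0 ≤ η * ‖z‖ ^ 3 := by positivity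
  nlinarith

/-- A mixture of the output density for Gaussian inputs with a wide Gaussian density, the latter
controlling inputs of large amplitude. -/
def testDensity (v inr : ℝ) (y : ℂ) : ℝ :=
  inr / (1 + inr) * ringDensity v inr y + (1 + inr)⁻¹ * complexGaussianDensity (1 + inr) y

theorem measurable_testDensity (v inr : ℝ) : Measurable (testDensity v inr) :=
  ((measurable_ringDensity v inr).const_mul _).add
    ((measurable_complexGaussianDensity _).const_mul _)

theorem testDensity_pos {v inr : ℝ} (hv : 0 < v) (hi : 0 < inr) (y : ℂ) :
    0 < testDensity v inr y := by
  have h1 := ringDensity_pos hv inr y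
  have h2 := complexGaussianDensity_pos (show 0 < 1 + inr by linarith) y
  unfold testDensity
  positivity

theorem lintegral_ringDensity {v : ℝ} (hv : 0 < v) (inr : ℝ) :
    ∫⁻ y, ENNReal.ofReal (ringDensity v inr y) = 1 := by
  lift v to ℝ≥0 using hv.le
  have hv' : v ≠ 0 := by
    rintro rfl
    simp at hv
  have h : ringLaw v inr Set.univ = 1 := measure_univ
  rwa [ringLaw_eq_withDensity hv', withDensity_apply _ MeasurableSet.univ,
    Measure.restrict_univ] at h

theorem lintegral_testDensity {v inr : ℝ} (hv : 0 < v) (hi : 0 < inr) :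
    ∫⁻ y, ENNReal.ofReal (testDensity v inr y) = 1 := by
  have hpos : 0 < 1 + inr := by linarith
  have e : ∀ y, ENNReal.ofReal (testDensity v inr y) =
      ENNReal.ofReal (inr / (1 + inr)) * ENNReal.ofReal (ringDensity v inr y) +
      ENNReal.ofReal (1 + inr)⁻¹ * ENNReal.ofReal (complexGaussianDensity (1 + inr) y) := by
    intro y
    have h1 := ringDensity_pos hv inr y
    have h2 := complexGaussianDensity_pos hpos y
    rw [testDensity, ENNReal.ofReal_add (by positivity) (by positivity),
      ENNReal.ofReal_mul (by positivity), ENNReal.ofReal_mul (by positivity)]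
  simp_rw [e]
  rw [lintegral_add_left ((measurable_ringDensity v inr).ennreal_ofReal.const_mul _),
    lintegral_const_mul _ (measurable_ringDensity v inr).ennreal_ofReal,
    lintegral_const_mul _ (measurable_complexGaussianDensity _).ennreal_ofReal,
    lintegral_ringDensity hv, lintegral_complexGaussianDensity hpos, mul_one, mul_one,
    ← ENNReal.ofReal_add (by positivity) (by positivity)]
  rw [show inr / (1 + inr) + (1 + inr)⁻¹ = 1 by field_simp; ring]
  simp

/-- A mixture dominates each weighted component, so the better one can be chosen for each x,
switching at |x|² = √I. -/
theorem eventually_neg_log_testDensity_le {v η : ℝ} (hv : 1 ≤ v) (hη : 0 < η) :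
    ∀ᶠ inr : ℝ in atTop, ∀ (θ : ℝ) (x z : ℂ),
      -Real.log (testDensity v inr
        ((√inr : ℂ) * Complex.exp ((θ : ℂ) * Complex.I) + (x + z))) ≤
      ringConstant v inr + radialPart θ (x + z) ^ 2 / v +
        η * (1 + ‖x‖ ^ 2 + ‖z‖ ^ 2 + ‖z‖ ^ 3) := by
  have hv0 : 0 < v := by linarith
  filter_upwards [eventually_neg_log_ringDensity_le hv (half_pos hη),
    eventually_neg_log_complexGaussianDensity_le hη, eventually_ge_atTop (2 / η),
    eventually_gt_atTop 0] with inr h1 h2 h3 hi θ x z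
  set y := (√inr : ℂ) * Complex.exp ((θ : ℂ) * Complex.I) + (x + z)
  have hpos : 0 < 1 + inr := by linarith
  have hr := ringDensity_pos hv0 inr y
  have hg := complexGaussianDensity_pos hpos y
  set Q := 1 + ‖x‖ ^ 2 + ‖z‖ ^ 2 + ‖z‖ ^ 3 with hQ
  have hQ1 : 1 ≤ Q := by
    have : 0 ≤ ‖x‖ ^ 2 + ‖z‖ ^ 2 + ‖z‖ ^ 3 := by positivity
    linarith
  rcases le_total (‖x‖ ^ 2) √inr with hx | hx
  · have e1 : Real.log (inr / (1 + inr) * ringDensity v inr y) ≤ Real.log (testDensity v inr y) := by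
      refine Real.log_le_log (by positivity) ?_
      rw [testDensity]
      linarith [show 0 ≤ (1 + inr)⁻¹ * complexGaussianDensity (1 + inr) y by positivity]
    rw [Real.log_mul (by positivity) hr.ne'] at e1
    have e2 : -Real.log (inr / (1 + inr)) ≤ η / 2 := by
      rw [← Real.log_inv, inv_div]
      refine (Real.log_le_sub_one_of_pos (by positivity)).trans ?_
      rw [div_sub_one hi.ne', div_le_iff₀ hi]
      rw [div_le_iff₀ hη] at h3
      linarith
    have e3 := h1 θ x z hx
    have e4 : η / 2 ≤ η / 2 * Q := le_mul_of_one_le_right (by positivity) hQ1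
    linarith
  · have e1 : Real.log ((1 + inr)⁻¹ * complexGaussianDensity (1 + inr) y) ≤
        Real.log (testDensity v inr y) := by
      refine Real.log_le_log (by positivity) ?_
      rw [testDensity]
      linarith [show 0 ≤ inr / (1 + inr) * ringDensity v inr y by positivity]
    rw [Real.log_mul (by positivity) hg.ne', Real.log_inv] at e1
    have e2 := h2 θ x z hx
    -- This lets the large-amplitude case satisfy the same bound as the ring case.
    have e3 : Real.log Real.pi ≤ ringConstant v inr := by
      have f1 : Real.log Real.pi ≤ Real.log (Real.pi * v) :=
        Real.log_le_log Real.pi_pos (le_mul_of_one_le_right Real.pi_pos.le hv)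
      have f2 : 0 ≤ Real.log (1 + 2 / v * √inr ^ 2) := Real.log_nonneg (by
        have : 0 ≤ 2 / v * √inr ^ 2 := by positivity
        linarith)
      rw [ringConstant]
      linarith [log_inv_sqrt_two_pi_nonpos]
    have e4 : 0 ≤ radialPart θ (x + z) ^ 2 / v := by positivity
    linarith

/-! ### Moments and integrability under the joint law. -/

theorem IsAdmissibleInput.integrable_norm_sq {S : ℝ≥0} {F : Measure ℂ}
    (hF : IsAdmissibleInput S F) : Integrable (fun x : ℂ => ‖x‖ ^ 2) F := by
  refine ⟨(by fun_prop : Measurable fun x : ℂ => ‖x‖ ^ 2).aestronglyMeasurable, ?_⟩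
  refine lt_of_le_of_lt (le_of_eq ?_) (hF.2.trans_lt ENNReal.coe_lt_top)
  refine lintegral_congr fun x => ?_
  rw [enorm_pow, enorm_norm]

theorem IsAdmissibleInput.integral_norm_sq_le {S : ℝ≥0} {F : Measure ℂ}
    (hF : IsAdmissibleInput S F) : ∫ x, ‖x‖ ^ 2 ∂F ≤ S := by
  rw [integral_eq_lintegral_of_nonneg_ae (ae_of_all _ fun x => by positivity)
    (by fun_prop : Measurable fun x : ℂ => ‖x‖ ^ 2).aestronglyMeasurable]
  refine ENNReal.toReal_le_of_le_ofReal S.2 ?_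
  rw [ENNReal.ofReal_coe_nnreal]
  refine le_trans (le_of_eq ?_) hF.2
  refine lintegral_congr fun x => ?_
  rw [← ofReal_norm, ENNReal.ofReal_pow (norm_nonneg _)]

theorem integral_norm_add_sq_complexGaussian (v : ℝ≥0) (x : ℂ) :
    ∫ z, ‖x + z‖ ^ 2 ∂complexGaussian v = ‖x‖ ^ 2 + v := by
  have e : ∀ z : ℂ, ‖x + z‖ ^ 2 =
      ‖x‖ ^ 2 + ‖z‖ ^ 2 + (2 * x.re * z.re + 2 * x.im * z.im) := fun z => by
    simp only [Complex.sq_norm, Complex.normSq_apply, Complex.add_re, Complex.add_im]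
    ring
  have hre : Integrable (fun z : ℂ => 2 * x.re * z.re) (complexGaussian v) :=
    ((memLp_re_complexGaussian v 1).integrable (by simp)).const_mul _
  have him : Integrable (fun z : ℂ => 2 * x.im * z.im) (complexGaussian v) :=
    ((memLp_im_complexGaussian v 1).integrable (by simp)).const_mul _
  have hn := integrable_norm_pow_complexGaussian v 2
  simp_rw [e]
  rw [integral_add ((integrable_const _).fun_add hn) (hre.fun_add him),
    integral_add (integrable_const _) hn, integral_add hre him, integral_const_mul,
    integral_const_mul, integral_re_complexGaussian, integral_im_complexGaussian,
    integral_norm_sq_complexGaussian]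
  simp

theorem integrable_noise_pow (F : Measure ℂ) [IsProbabilityMeasure F] (n : ℕ) :
    Integrable (fun p : ℂ × ℝ × ℂ => ‖p.2.2‖ ^ n) (sourceLaw F) :=
  ((integrable_norm_pow_complexGaussian 1 n).comp_snd uniformPhase).comp_snd F

theorem integral_noise_pow (F : Measure ℂ) [IsProbabilityMeasure F] (n : ℕ) :
    ∫ p, ‖p.2.2‖ ^ n ∂sourceLaw F = ∫ z, ‖z‖ ^ n ∂complexGaussian 1 := by
  rw [sourceLaw, integral_fun_snd (fun q : ℝ × ℂ => ‖q.2‖ ^ n),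
    integral_fun_snd (fun z : ℂ => ‖z‖ ^ n)]
  simp

theorem integral_input (F : Measure ℂ) [IsProbabilityMeasure F] (f : ℂ → ℝ) :
    ∫ p, f p.1 ∂sourceLaw F = ∫ x, f x ∂F := by
  rw [sourceLaw, integral_fun_fst f]
  simp

theorem integrable_norm_add_noise_sq {F : Measure ℂ} [IsProbabilityMeasure F]
    (hF : Integrable (fun x : ℂ => ‖x‖ ^ 2) F) :
    Integrable (fun p : ℂ × ℝ × ℂ => ‖p.1 + p.2.2‖ ^ 2) (sourceLaw F) := by
  have h1 : Integrable (fun p : ℂ × ℝ × ℂ => ‖p.1‖ ^ 2) (sourceLaw F) := hF.comp_fst _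
  refine ((h1.const_mul 2).add ((integrable_noise_pow F 2).const_mul 2)).mono'
    (Measurable.aestronglyMeasurable (by fun_prop)) (ae_of_all _ fun p => ?_)
  rw [Real.norm_of_nonneg (by positivity)]
  have h := pow_le_pow_left₀ (norm_nonneg _) (norm_add_le p.1 p.2.2) 2
  simp only [Pi.add_apply]
  nlinarith [sq_nonneg (‖p.1‖ - ‖p.2.2‖)]

theorem integrable_radialPart_add_sq {F : Measure ℂ} [IsProbabilityMeasure F]
    (hF : Integrable (fun x : ℂ => ‖x‖ ^ 2) F) :
    Integrable (fun p : ℂ × ℝ × ℂ => radialPart p.2.1 (p.1 + p.2.2) ^ 2) (sourceLaw F) := by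
  refine (integrable_norm_add_noise_sq hF).mono' ?_ (ae_of_all _ fun p => ?_)
  · have hc : Continuous fun p : ℂ × ℝ × ℂ => radialPart p.2.1 (p.1 + p.2.2) ^ 2 := by
      unfold radialPart
      fun_prop
    exact hc.aestronglyMeasurable
  · rw [Real.norm_of_nonneg (sq_nonneg _)]
    exact radialPart_sq_le _ _

theorem integral_norm_add_noise_sq {F : Measure ℂ} [IsProbabilityMeasure F]
    (hF : Integrable (fun x : ℂ => ‖x‖ ^ 2) F) :
    ∫ p, ‖p.1 + p.2.2‖ ^ 2 ∂sourceLaw F = ∫ x, ‖x‖ ^ 2 ∂F + 1 := by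
  have hi := integrable_norm_add_noise_sq hF
  rw [sourceLaw] at hi ⊢
  rw [integral_prod _ hi]
  have e : ∀ x : ℂ, ∫ q : ℝ × ℂ, ‖x + q.2‖ ^ 2 ∂uniformPhase.prod (complexGaussian 1) =
      ‖x‖ ^ 2 + 1 := fun x => by
    rw [integral_fun_snd (fun z : ℂ => ‖x + z‖ ^ 2), integral_norm_add_sq_complexGaussian]
    simp
  simp_rw [e]
  rw [integral_add hF (integrable_const _)]
  simp

theorem integral_radialPart_add_sq {F : Measure ℂ} [IsProbabilityMeasure F]
    (hF : Integrable (fun x : ℂ => ‖x‖ ^ 2) F) :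
    ∫ p, radialPart p.2.1 (p.1 + p.2.2) ^ 2 ∂sourceLaw F = (∫ x, ‖x‖ ^ 2 ∂F + 1) / 2 := by
  have hi := integrable_radialPart_add_sq hF
  rw [sourceLaw] at hi ⊢
  rw [integral_prod _ hi]
  have e : ∀ x : ℂ, ∫ q : ℝ × ℂ, radialPart q.1 (x + q.2) ^ 2
      ∂uniformPhase.prod (complexGaussian 1) = (‖x‖ ^ 2 + 1) / 2 := fun x => by
    have hz : Integrable (fun z : ℂ => ‖x + z‖ ^ 2) (complexGaussian 1) := by
      refine ((integrable_const (2 * ‖x‖ ^ 2)).add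
        ((integrable_norm_pow_complexGaussian 1 2).const_mul 2)).mono'
        (Measurable.aestronglyMeasurable (by fun_prop)) (ae_of_all _ fun z => ?_)
      rw [Real.norm_of_nonneg (by positivity)]
      have h := pow_le_pow_left₀ (norm_nonneg _) (norm_add_le x z) 2
      simp only [Pi.add_apply]
      nlinarith [sq_nonneg (‖x‖ - ‖z‖)]
    have hx : Integrable (fun q : ℝ × ℂ => radialPart q.1 (x + q.2) ^ 2)
        (uniformPhase.prod (complexGaussian 1)) := by
      have hc : Continuous fun q : ℝ × ℂ => radialPart q.1 (x + q.2) ^ 2 := by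
        unfold radialPart
        fun_prop
      refine (hz.comp_snd uniformPhase).mono' hc.aestronglyMeasurable (ae_of_all _ fun q => ?_)
      rw [Real.norm_of_nonneg (sq_nonneg _)]
      exact radialPart_sq_le _ _
    rw [integral_prod_symm _ hx]
    simp_rw [integral_radialPart_sq]
    rw [integral_div, integral_norm_add_sq_complexGaussian]
    simp
  simp_rw [e]
  rw [integral_div, integral_add hF (integrable_const _)]
  simp

theorem integrable_log_ringDensity_disturbance (F : Measure ℂ) [IsProbabilityMeasure F] (inr : ℝ) :
    Integrable (fun p => Real.log (ringDensity 1 inr (disturbance inr p))) (sourceLaw F) :=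
  integrable_log_ringDensity one_pos inr (measurable_disturbance inr)
    (integrable_norm_sq_ring_add _ (measurable_fst.comp measurable_snd)
      (measurable_snd.comp measurable_snd) (integrable_noise_pow F 2))

theorem integral_log_ringDensity_disturbance (F : Measure ℂ) [IsProbabilityMeasure F] (inr : ℝ) :
    ∫ p, Real.log (ringDensity 1 inr (disturbance inr p)) ∂sourceLaw F = -ringEntropy 1 inr := by
  rw [sourceLaw]
  refine (integral_fun_snd (fun q : ℝ × ℂ => Real.log (ringDensity 1 inr
    ((√inr : ℂ) * Complex.exp ((q.1 : ℂ) * Complex.I) + q.2)))).trans ?_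
  simp [ringEntropy, integral_neg]

theorem output_eq (inr : ℝ) (p : ℂ × ℝ × ℂ) : p.1 + disturbance inr p =
    (√inr : ℂ) * Complex.exp ((p.2.1 : ℂ) * Complex.I) + (p.1 + p.2.2) := by
  rw [disturbance]
  ring

theorem measurable_output (inr : ℝ) : Measurable fun p => p.1 + disturbance inr p :=
  measurable_fst.add (measurable_disturbance inr)

theorem integrable_norm_sq_output {F : Measure ℂ} [IsProbabilityMeasure F]
    (hF : Integrable (fun x : ℂ => ‖x‖ ^ 2) F) (inr : ℝ) :
    Integrable (fun p => ‖p.1 + disturbance inr p‖ ^ 2) (sourceLaw F) := by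
  simp_rw [output_eq]
  exact integrable_norm_sq_ring_add _ (measurable_fst.comp measurable_snd)
    (measurable_fst.add (measurable_snd.comp measurable_snd)) (integrable_norm_add_noise_sq hF)

theorem integrable_log_outputDensity {F : Measure ℂ} [IsProbabilityMeasure F]
    (hF : Integrable (fun x : ℂ => ‖x‖ ^ 2) F) (inr : ℝ) :
    Integrable (fun p => Real.log (outputDensity F inr (p.1 + disturbance inr p)))
      (sourceLaw F) := by
  obtain ⟨C, hC⟩ := exists_abs_log_outputDensity_le F inr
  exact ((integrable_const C).add ((integrable_norm_sq_output hF inr).const_mul 2)).mono'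
    ((measurable_outputDensity F inr).comp (measurable_output inr)).log.aestronglyMeasurable
    (ae_of_all _ fun p => hC _)

/-! ### Information bounds for general inputs, and the exact value for the Gaussian input. -/

/-- An upper bound on the information through a test density `q` for the output. -/
theorem inputOutputInformation_le {F : Measure ℂ} [IsProbabilityMeasure F]
    (hF : Integrable (fun x : ℂ => ‖x‖ ^ 2) F) (inr : ℝ) {q : ℂ → ℝ} (hq : Measurable q)
    (hq0 : ∀ y, 0 < q y) (hq1 : ∫⁻ y, ENNReal.ofReal (q y) ≤ 1) {A : ℂ × ℝ × ℂ → ℝ}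
    (hA : Integrable A (sourceLaw F))
    (hle : ∀ p, -Real.log (q (p.1 + disturbance inr p)) ≤ A p) :
    inputOutputInformation F inr ≤
      ENNReal.ofReal (∫ p, A p ∂sourceLaw F - ringEntropy 1 inr) := by
  have hlogint := integrable_log_outputDensity hF inr
  have hlaw := snd_inputOutputLaw_eq_withDensity F inr
  rw [inputOutputInformation_eq F inr (measurable_outputDensity F inr) (outputDensity_pos F inr)
    hlaw (integrable_log_ringDensity_disturbance F inr) hlogint,
    integral_log_ringDensity_disturbance]
  rw [snd_inputOutputLaw] at hlaw
  have h := neg_integral_log_le_of_density (measurable_output inr)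
    (measurable_outputDensity F inr) hq (outputDensity_pos F inr) hq0 hlaw hq1 hlogint hA hle
  exact ENNReal.ofReal_le_ofReal (by linarith)

/-- Input and noise add up to a Gaussian of variance S + 1 independent of the phase. -/
theorem snd_inputOutputLaw_complexGaussian (S : ℝ≥0) (inr : ℝ) :
    (inputOutputLaw (complexGaussian S) inr).snd = ringLaw (S + 1) inr := by
  refine Measure.ext_of_lintegral _ fun f hf => ?_
  rw [Measure.snd, lintegral_map hf measurable_snd,
    lintegral_inputOutputLaw _ _ (f := fun q => f q.2) (hf.comp measurable_snd), ringLaw, ringLaw,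
    lintegral_map hf (measurable_ringMap inr),
    lintegral_prod (fun p : ℝ × ℂ => f ((√inr : ℂ) * Complex.exp ((p.1 : ℂ) * Complex.I) + p.2))
      (hf.comp (measurable_ringMap inr)).aemeasurable]
  calc ∫⁻ x, ∫⁻ w, f (x + w) ∂(uniformPhase.prod (complexGaussian 1)).map
        (fun p : ℝ × ℂ => (√inr : ℂ) * Complex.exp ((p.1 : ℂ) * Complex.I) + p.2)
        ∂complexGaussian S
      = ∫⁻ x, ∫⁻ θ : ℝ, ∫⁻ z, f ((√inr : ℂ) * Complex.exp ((θ : ℂ) * Complex.I) + (x + z))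
          ∂complexGaussian 1 ∂uniformPhase ∂complexGaussian S := by
        refine lintegral_congr fun x => ?_
        have hx : Measurable fun w => f (x + w) := hf.comp (measurable_const_add x)
        rw [lintegral_map hx (measurable_ringMap inr), lintegral_prod (fun p : ℝ × ℂ =>
          f (x + ((√inr : ℂ) * Complex.exp ((p.1 : ℂ) * Complex.I) + p.2)))
          (hx.comp (measurable_ringMap inr)).aemeasurable]
        simp_rw [add_left_comm x]
    _ = ∫⁻ θ : ℝ, ∫⁻ x, ∫⁻ z, f ((√inr : ℂ) * Complex.exp ((θ : ℂ) * Complex.I) + (x + z))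
          ∂complexGaussian 1 ∂complexGaussian S ∂uniformPhase := by
        refine lintegral_lintegral_swap (Measurable.aemeasurable ?_)
        refine Measurable.lintegral_prod_right' (f := fun q : (ℂ × ℝ) × ℂ =>
          f ((√inr : ℂ) * Complex.exp ((q.1.2 : ℂ) * Complex.I) + (q.1.1 + q.2))) ?_
        exact hf.comp (Continuous.measurable (by fun_prop))
    _ = _ := by
        refine lintegral_congr fun θ => ?_
        exact lintegral_lintegral_complexGaussian_add S 1
          (f := fun u => f ((√inr : ℂ) * Complex.exp ((θ : ℂ) * Complex.I) + u))
          (hf.comp (measurable_const_add _))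

theorem inputOutputInformation_complexGaussian (S : ℝ≥0) (inr : ℝ) :
    inputOutputInformation (complexGaussian S) inr =
      ENNReal.ofReal (ringEntropy (S + 1) inr - ringEntropy 1 inr) := by
  have hv : S + 1 ≠ 0 := by positivity
  have hv0 : (0 : ℝ) < (S + 1 : ℝ≥0) := by positivity
  have hF := integrable_norm_pow_complexGaussian S 2
  have hsnd := snd_inputOutputLaw_complexGaussian S inr
  have hlaw := hsnd
  rw [ringLaw_eq_withDensity hv] at hlaw
  have hm : Measurable fun y => Real.log (ringDensity (S + 1 : ℝ≥0) inr y) :=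
    (measurable_ringDensity _ inr).log
  rw [inputOutputInformation_eq _ inr (measurable_ringDensity _ inr) (ringDensity_pos hv0 inr)
    hlaw (integrable_log_ringDensity_disturbance _ inr)
    (integrable_log_ringDensity hv0 inr (measurable_output inr) (integrable_norm_sq_output hF inr)),
    integral_log_ringDensity_disturbance]
  have h : ∫ p, Real.log (ringDensity (S + 1 : ℝ≥0) inr (p.1 + disturbance inr p))
      ∂sourceLaw (complexGaussian S) = -ringEntropy (S + 1) inr := by
    rw [← integral_map (f := fun y => Real.log (ringDensity (S + 1 : ℝ≥0) inr y))
      (measurable_output inr).aemeasurable hm.aestronglyMeasurable, ← snd_inputOutputLaw, hsnd,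
      ringLaw, integral_map (measurable_ringMap inr).aemeasurable hm.aestronglyMeasurable,
      ringEntropy, integral_neg, neg_neg]
  rw [h]
  congr 1
  ring

/-! ### The high-interference limits. -/

theorem tendsto_log_sub_log {v : ℝ} (hv : 0 < v) :
    Tendsto (fun inr : ℝ => 1 / 2 * Real.log (1 + 2 / v * √inr ^ 2) -
      1 / 2 * Real.log (1 + 2 * √inr ^ 2)) atTop (𝓝 (-(1 / 2 * Real.log v))) := by
  have hinv := tendsto_inv_atTop_zero (𝕜 := ℝ)
  have h1 := ((hinv.add_const (2 / v)).log (by positivity : (0 : ℝ) + 2 / v ≠ 0)).sub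
    ((hinv.add_const 2).log (by norm_num))
  have h2 := h1.const_mul (1 / 2)
  rw [zero_add, zero_add, Real.log_div two_ne_zero hv.ne',
    show 1 / 2 * (Real.log 2 - Real.log v - Real.log 2) = -(1 / 2 * Real.log v) by ring] at h2
  refine h2.congr' ?_
  filter_upwards [eventually_gt_atTop 0] with t ht
  rw [Real.sq_sqrt ht.le, show 1 + 2 / v * t = t * (t⁻¹ + 2 / v) by field_simp,
    show 1 + 2 * t = t * (t⁻¹ + 2) by field_simp, Real.log_mul ht.ne' (by positivity),
    Real.log_mul ht.ne' (by positivity)]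
  ring

/-- The balance log v − ½ log v, shared by the achievability and converse arguments. -/
theorem tendsto_ringConstant_sub_ringEntropy {v : ℝ} (hv : 0 < v) :
    Tendsto (fun inr : ℝ => ringConstant v inr + 1 / 2 - ringEntropy 1 inr) atTop
      (𝓝 (1 / 2 * Real.log v)) := by
  have h1 := tendsto_ringEntropy (v := 1) one_ne_zero
  have h2 := (tendsto_log_sub_log hv).sub h1
  have h3 := h2.const_add (Real.log (Real.pi * v) + 1 / 2 - Real.log (√(2 * Real.pi))⁻¹)
  refine (h3.congr fun inr => ?_).trans (le_of_eq ?_)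
  · rw [ringConstant]
    simp only [NNReal.coe_one, div_one]
    ring
  · rw [Real.log_mul Real.pi_pos.ne' hv.ne']
    simp only [NNReal.coe_one, mul_one]
    congr 1
    ring

theorem tendsto_inputOutputInformation_complexGaussian (S : ℝ≥0) :
    Tendsto (fun inr : ℝ => inputOutputInformation (complexGaussian S) inr) atTop
      (𝓝 (ENNReal.ofReal (1 / 2 * Real.log (1 + (S : ℝ))))) := by
  have hv0 : (0 : ℝ) < (S + 1 : ℝ≥0) := by positivity
  simp_rw [inputOutputInformation_complexGaussian]
  refine ENNReal.tendsto_ofReal ?_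
  have h1 := (tendsto_ringConstant_sub_ringEntropy hv0).add
    ((tendsto_ringEntropy (v := S + 1) (by positivity)).sub_const
      (Real.log (Real.pi * (S + 1 : ℝ≥0)) + 1 / 2 - Real.log (√(2 * Real.pi))⁻¹))
  refine (h1.congr fun inr => ?_).trans (le_of_eq ?_)
  · rw [ringConstant]
    ring
  · rw [sub_self, add_zero, NNReal.coe_add, NNReal.coe_one, add_comm (S : ℝ)]

theorem eventually_capacity_le (S : ℝ≥0) {δ : ℝ} (hδ : 0 < δ) :
    ∀ᶠ inr : ℝ in atTop,
      capacity S inr ≤ ENNReal.ofReal (1 / 2 * Real.log (1 + (S : ℝ)) + δ) := by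
  set v : ℝ := 1 + S with hv
  have hv1 : 1 ≤ v := by simp [hv]
  have hv0 : 0 < v := by linarith
  set M := ∫ z, ‖z‖ ^ 3 ∂complexGaussian 1 with hM
  have hM0 : 0 ≤ M := integral_nonneg fun z => by positivity
  -- The denominator bounds the mean of 1 + |X|² + |Z|² + |Z|³ for every admissible input, so the
  -- error is at most δ/2 uniformly.
  set η := δ / 2 / (2 + S + M) with hη
  have hden : 0 < 2 + (S : ℝ) + M := by positivity
  have hη0 : 0 < η := by positivity
  have hηM : η * (2 + S + M) = δ / 2 := by
    rw [hη]
    field_simp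
  filter_upwards [eventually_neg_log_testDensity_le hv1 hη0, eventually_gt_atTop 0,
    (tendsto_ringConstant_sub_ringEntropy hv0).eventually
      (ge_mem_nhds (show 1 / 2 * Real.log v < 1 / 2 * Real.log v + δ / 2 by linarith))]
    with inr hle hi hc
  refine iSup₂_le fun F hF => ?_
  have : IsProbabilityMeasure F := hF.1
  have hF2 := hF.integrable_norm_sq
  have hFS := hF.integral_norm_sq_le
  have i1 : Integrable (fun p : ℂ × ℝ × ℂ => radialPart p.2.1 (p.1 + p.2.2) ^ 2 / v)
      (sourceLaw F) := (integrable_radialPart_add_sq hF2).div_const v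
  have i2 : Integrable (fun p : ℂ × ℝ × ℂ => ‖p.1‖ ^ 2) (sourceLaw F) := hF2.comp_fst _
  have i3 := integrable_noise_pow F 2
  have i4 := integrable_noise_pow F 3
  have i12 := (integrable_const (μ := sourceLaw F) (1 : ℝ)).fun_add i2
  have i123 := i12.fun_add i3
  have iQ := i123.fun_add i4
  have iC := (integrable_const (μ := sourceLaw F) (ringConstant v inr)).fun_add i1
  refine (inputOutputInformation_le hF2 inr (measurable_testDensity v inr)
    (testDensity_pos hv0 hi) (lintegral_testDensity hv0 hi).le (iC.fun_add (iQ.const_mul η))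
    fun p => ?_).trans (ENNReal.ofReal_le_ofReal ?_)
  · rw [output_eq]
    exact hle p.2.1 p.1 p.2.2
  · rw [integral_add iC (iQ.const_mul η), integral_add (integrable_const _) i1, integral_div,
      integral_radialPart_add_sq hF2, integral_const_mul, integral_add i123 i4,
      integral_add i12 i3, integral_add (integrable_const _) i2, integral_noise_pow,
      integral_noise_pow, integral_norm_sq_complexGaussian,
      integral_input F (fun x => ‖x‖ ^ 2), ← hM]
    simp only [integral_const, probReal_univ, smul_eq_mul, one_mul, NNReal.coe_one]
    -- The mean squared radial part is at most v/2 by the power constraint; this is the term ½ in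
    -- the ring entropy.
    have h1 : (∫ x, ‖x‖ ^ 2 ∂F + 1) / 2 / v ≤ 1 / 2 := by
      rw [div_le_iff₀ hv0]
      linarith
    have h2 : η * (1 + ∫ x, ‖x‖ ^ 2 ∂F + 1 + M) ≤ η * (2 + S + M) :=
      mul_le_mul_of_nonneg_left (by linarith) hη0.le
    linarith

theorem tendsto_capacity (S : ℝ≥0) :
    Tendsto (fun inr : ℝ => capacity S inr) atTop
      (𝓝 (ENNReal.ofReal (1 / 2 * Real.log (1 + (S : ℝ))))) := by
  have hlog : 0 ≤ 1 / 2 * Real.log (1 + (S : ℝ)) := by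
    have := Real.log_nonneg (show (1 : ℝ) ≤ 1 + S by simp)
    positivity
  refine tendsto_order.2 ⟨fun a ha => ?_, fun a ha => ?_⟩
  · filter_upwards [(tendsto_order.1 (tendsto_inputOutputInformation_complexGaussian S)).1 a ha]
      with inr h
    exact h.trans_le (le_iSup₂_of_le (complexGaussian S) (isAdmissibleInput_complexGaussian S) le_rfl)
  · obtain ⟨b, hb1, hb2⟩ := exists_between ha
    have hbtop : b ≠ ∞ := (hb2.trans_le le_top).ne
    have hb : 1 / 2 * Real.log (1 + (S : ℝ)) < b.toReal :=
      (ENNReal.ofReal_lt_iff_lt_toReal hlog hbtop).1 hb1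
    filter_upwards [eventually_capacity_le S (sub_pos.2 hb)] with inr h
    refine h.trans_lt ?_
    rwa [add_sub_cancel, ENNReal.ofReal_toReal hbtop]

/-! ### The interference-free channel. -/

theorem disturbance_zero (p : ℂ × ℝ × ℂ) : disturbance 0 p = p.2.2 := by
  simp [disturbance]

theorem ringEntropy_zero_sub (S : ℝ≥0) :
    ringEntropy (S + 1) 0 - ringEntropy 1 0 = Real.log (1 + (S : ℝ)) := by
  rw [ringEntropy_zero (by positivity), ringEntropy_zero one_ne_zero, NNReal.coe_add,
    NNReal.coe_one, Real.log_mul Real.pi_pos.ne' (by positivity), mul_one, add_comm (S : ℝ)]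
  ring

theorem capacity_zero (S : ℝ≥0) :
    capacity S 0 = ENNReal.ofReal (Real.log (1 + (S : ℝ))) := by
  refine le_antisymm (iSup₂_le fun F hF => ?_) ?_
  · have : IsProbabilityMeasure F := hF.1
    have hF2 := hF.integrable_norm_sq
    have hFS := hF.integral_norm_sq_le
    have hv0 : (0 : ℝ) < (S + 1 : ℝ≥0) := by positivity
    have i1 := (integrable_norm_add_noise_sq hF2).div_const ((S + 1 : ℝ≥0) : ℝ)
    -- At radius 0 the ring density is the Gaussian density of variance S + 1, so this is the
    -- maximum entropy argument.
    refine (inputOutputInformation_le hF2 0 (measurable_ringDensity (S + 1 : ℝ≥0) 0)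
      (ringDensity_pos hv0 0) (lintegral_ringDensity hv0 0).le
      ((integrable_const (Real.log (Real.pi * (S + 1 : ℝ≥0)))).fun_add i1) fun p => ?_).trans
      (ENNReal.ofReal_le_ofReal ?_)
    · rw [disturbance_zero, neg_log_ringDensity hv0]
      simp [logBesselCorrection_zero]
    · rw [← ringEntropy_zero_sub, ringEntropy_zero (v := S + 1) (by positivity),
        integral_add (integrable_const _) i1, integral_div, integral_norm_add_noise_sq hF2]
      simp only [integral_const, probReal_univ, smul_eq_mul, one_mul]
      have h1 : (∫ x, ‖x‖ ^ 2 ∂F + 1) / ((S + 1 : ℝ≥0) : ℝ) ≤ 1 := by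
        rw [div_le_one hv0, NNReal.coe_add, NNReal.coe_one]
        linarith
      linarith
  · rw [← ringEntropy_zero_sub, ← inputOutputInformation_complexGaussian]
    exact le_iSup₂_of_le (complexGaussian S) (isAdmissibleInput_complexGaussian S) le_rfl

end RadarChannel

end

theorem theorem2 (S : ℝ≥0) :
    -- the capacity at high INR
    Tendsto (fun inr : ℝ => RadarChannel.capacity S inr) atTop
        (𝓝 (ENNReal.ofReal (1 / 2 * Real.log (1 + (S : ℝ))))) ∧
    -- twice this limit is the capacity of the interference-free channel
    RadarChannel.capacity S 0 = ENNReal.ofReal (Real.log (1 + (S : ℝ))) ∧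
    -- upper bound for every power-constrained input
    (∀ F : Measure ℂ, RadarChannel.IsAdmissibleInput S F →
      limsup (fun inr : ℝ => RadarChannel.inputOutputInformation F inr) atTop ≤
        ENNReal.ofReal (1 / 2 * Real.log (1 + (S : ℝ)))) ∧
    -- the proper-complex Gaussian input is admissible and asymptotically achieves the limit
    RadarChannel.IsAdmissibleInput S (RadarChannel.complexGaussian S) ∧
    Tendsto (fun inr : ℝ =>
        RadarChannel.inputOutputInformation (RadarChannel.complexGaussian S) inr) atTop
      (𝓝 (ENNReal.ofReal (1 / 2 * Real.log (1 + (S : ℝ))))) := by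
  refine ⟨RadarChannel.tendsto_capacity S, RadarChannel.capacity_zero S, fun F hF => ?_,
    RadarChannel.isAdmissibleInput_complexGaussian S,
    RadarChannel.tendsto_inputOutputInformation_complexGaussian S⟩
  rw [← (RadarChannel.tendsto_capacity S).limsup_eq]
  exact limsup_le_limsup (Eventually.of_forall fun inr => le_iSup₂_of_le F hF le_rfl)
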